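/- Let $d$ be a dimension and let $\mathcal F f(\omega)=\int e^{-2\pi i x\cdot\omega}f(x)\,dx$. For a matrix $A=\begin{pmatrix}A_{11}&A_{12}\\A_{21}&A_{22}\end{pmatrix}\in\mathrm{GL}(2d,\mathbb R)$ with blocks $A_{ij}\in\mathbb R^{d\times d}$, the matrix-Wigner distribution is $$\mathcal B_A(f,g)(x,\omega)=\int_{\mathbb R^d}e^{-2\pi i\omega\cdot y}\,f(A_{11}x+A_{12}y)\,\overline{g(A_{21}x+A_{22}y)}\,dy ,$$ and $W(f,g)(x,\omega)=\int_{\mathbb R^d}e^{-2\pi i\omega\cdot y}f(x+\tfrac y2)\overline{g(x-\tfrac y2)}\,dy$ is the cross-Wigner distribution. A time-frequency distribution $Q$ belongs to Cohen's class if there is a tempered distribution $\theta\in\mathcal S'(\mathbb R^{2d})$, called a Cohen kernel of $Q$, with $Q(f,g)=W(f,g)*\theta$ for all Schwartz functions $f,g\in\mathcal S(\mathbb R^d)$. Let $S_0=M^1$ denote the Feichtinger algebra (the continuous integrable functions whose short-time Fourier transform with Gaussian window is integrable, normed by the $L^1$-norm of that transform) and $S_0'$ its dual space. (i) Let $A\in\mathrm{GL}(2d,\mathbb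 R)$. Then $\mathcal B_A$ belongs to Cohen's class if and only if $$A=A_M=\begin{pmatrix}I&M+\tfrac12 I\\ I&M-\tfrac12 I\end{pmatrix}\quad\text{for some }M\in\mathbb R^{d\times d}.$$ (ii) For every $M\in\mathbb R^{d\times d}$ let $\Theta_M(\xi,\eta)=e^{-2\pi i\,\xi\cdot M\eta}$ and $\theta_M=\mathcal F\Theta_M$. As a tempered distribution, $\theta_M$ is a Cohen kernel of $W_M:=\mathcal B_{A_M}$. As an element of $S_0'(\mathbb R^{2d})$ it satisfies $$W_M(f,g)=W(f,g)*\theta_M\qquad\text{for all } f,g\in S_0(\mathbb R^d),$$ where $W(f,g)\in S_0(\mathbb R^{2d})$. (iii) If $M$ is invertible, then $\theta_M\in S_0'(\mathbb R^{2d})$ is the function $$\theta_M(x,\omega)=\frac1{|\det M|}\,e^{2\pi i\,\omega\cdot M^{-1}x}.$$ -/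

import Mathlib

open MeasureTheory FourierTransform SchwartzMap ComplexConjugate
open scoped RealInnerProductSpace BoundedContinuousFunction

noncomputable section

namespace TimeFreq

section General

set_option linter.unusedSectionVars false

variable {V : Type*} [NormedAddCommGroup V] [InnerProductSpace ℝ V] [FiniteDimensional ℝ V]
  [MeasurableSpace V] [BorelSpace V]

/-! ### The short-time Fourier transform and the Feichtinger algebra -/

/-- The short-time Fourier transform with window `g`:
`V_g f (x, ω) = ∫ f(t) conj(g(t - x)) exp(-2πi t·ω) dt`. -/
def stft (g f : V → ℂ) (x ω : V) : ℂ :=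
  𝓕 (fun t : V => f t * conj (g (t - x))) ω

variable (V) in
/-- The Gaussian window `exp(-π|t|²)`. -/
def gauss : V → ℂ := fun t => Complex.exp (-(Real.pi : ℂ) * (‖t‖ : ℂ) ^ 2)

/-- Membership in the Feichtinger algebra `M¹ = S₀`: continuous integrable functions whose
short-time Fourier transform with Gaussian window is integrable over phase space. (A tempered
distribution whose short-time Fourier transform is integrable is such a function.) -/
def MemFeichtinger (f : V → ℂ) : Prop :=
  Continuous f ∧ Integrable f ∧ Integrable (fun z : V × V => stft (gauss V) f z.1 z.2)

/-- The norm of `M¹`: the `L¹`-norm of the short-time Fourier transform. -/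
def feichtingerNorm (f : V → ℂ) : ℝ := ∫ z : V × V, ‖stft (gauss V) f z.1 z.2‖

lemma gauss_eq_ofReal (t : V) :
    gauss V t = ((Real.exp (-Real.pi * ‖t‖ ^ 2) : ℝ) : ℂ) := by
  simp [gauss]

lemma conj_gauss (t : V) : conj (gauss V t) = gauss V t := by
  rw [gauss_eq_ofReal, Complex.conj_ofReal]

lemma gauss_neg (t : V) : gauss V (-t) = gauss V t := by simp [gauss]

lemma continuous_gauss : Continuous (gauss V) := by
  unfold gauss; fun_prop

lemma norm_gauss_le (t : V) : ‖gauss V t‖ ≤ 1 := by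
  rw [gauss_eq_ofReal, Complex.norm_real, Real.norm_of_nonneg (Real.exp_pos _).le]
  apply Real.exp_le_one_iff.2
  have := mul_nonneg Real.pi_pos.le (sq_nonneg ‖t‖)
  linarith

lemma integrable_gauss : Integrable (gauss V) := by
  have := GaussianFourier.integrable_cexp_neg_mul_sq_norm_add (V := V) (b := (Real.pi : ℂ))
    (by simpa using Real.pi_pos) 0 0
  have e : gauss V = fun v : V => Complex.exp (-(Real.pi : ℂ) * (‖v‖ : ℂ) ^ 2
      + 0 * ((⟪(0 : V), v⟫ : ℝ) : ℂ)) := by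
    ext v; simp [gauss]
  rw [e]; exact this

lemma fourier_gauss (w : V) : 𝓕 (gauss V) w = gauss V w := by
  have h := fourier_gaussian_innerProductSpace (V := V) (b := (Real.pi : ℂ))
    (by simpa using Real.pi_pos) w
  have hpi : (Real.pi : ℂ) ≠ 0 := by exact_mod_cast Real.pi_ne_zero
  rw [div_self hpi, Complex.one_cpow, one_mul] at h
  unfold gauss
  rw [h]
  congr 1
  field_simp

lemma integrable_mul_gauss {f : V → ℂ} (hf : Integrable f) (x : V) :
    Integrable (fun t : V => f t * conj (gauss V (t - x))) := by
  simp_rw [conj_gauss]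
  refine hf.mul_bdd (c := 1) ?_ ?_
  · exact (continuous_gauss.comp (continuous_id.sub continuous_const)).aestronglyMeasurable
  · exact Filter.Eventually.of_forall fun t => norm_gauss_le _

lemma stft_add {f g : V → ℂ} (hf : Integrable f) (hg : Integrable g) (x ω : V) :
    stft (gauss V) (f + g) x ω = stft (gauss V) f x ω + stft (gauss V) g x ω := by
  unfold stft
  simp only [Real.fourier_eq]
  rw [← integral_add ((Real.fourierIntegral_convergent_iff ω).2 (integrable_mul_gauss hf x))
    ((Real.fourierIntegral_convergent_iff ω).2 (integrable_mul_gauss hg x))]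
  simp [add_mul, smul_add]

lemma stft_smul (c : ℂ) (f : V → ℂ) (x ω : V) :
    stft (gauss V) (c • f) x ω = c * stft (gauss V) f x ω := by
  unfold stft
  simp only [Real.fourier_eq]
  rw [← integral_const_mul]
  congr 1; ext t
  simp only [Pi.smul_apply, smul_eq_mul, Circle.smul_def]
  ring

variable (V) in
/-- The Feichtinger algebra `S₀ = M¹` as a space of functions. -/
def Feichtinger : Submodule ℂ (V → ℂ) where
  carrier := {f | MemFeichtinger f}
  zero_mem' := by
    refine ⟨continuous_const, integrable_zero _ _ _, ?_⟩
    have : (fun z : V × V => stft (gauss V) (0 : V → ℂ) z.1 z.2) = fun _ => 0 := by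
      ext z; simp [stft, Real.fourier_eq]
    rw [this]; exact integrable_zero _ _ _
  add_mem' := by
    rintro f g ⟨hf1, hf2, hf3⟩ ⟨hg1, hg2, hg3⟩
    refine ⟨hf1.add hg1, hf2.add hg2, ?_⟩
    simp only [stft_add hf2 hg2]
    exact hf3.add hg3
  smul_mem' := by
    rintro c f ⟨hf1, hf2, hf3⟩
    refine ⟨hf1.const_smul c, hf2.smul c, ?_⟩
    simpa only [stft_smul] using hf3.const_mul c

/-! ### Closure of the Feichtinger algebra under `F ↦ F(z - ·)` and the Fourier transform -/

lemma stft_comp_sub (f : V → ℂ) (z x ω : V) :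
    ‖stft (gauss V) (fun t => f (z - t)) x ω‖ = ‖stft (gauss V) f (z - x) (-ω)‖ := by
  have : stft (gauss V) (fun t => f (z - t)) x ω
      = (Real.fourierChar (-⟪z, ω⟫) : ℂ) * stft (gauss V) f (z - x) (-ω) := by
    unfold stft
    simp only [Real.fourier_eq]
    rw [← integral_const_mul,
      ← integral_sub_left_eq_self (fun t => (Real.fourierChar (-⟪z, ω⟫) : ℂ) *
        (Real.fourierChar (-⟪t, -ω⟫) • (f t * conj (gauss V (t - (z - x)))))) volume z]
    congr 1; ext t
    have h1 : z - t - (z - x) = -(t - x) := by abel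
    have h2 : (Real.fourierChar (-⟪t, ω⟫) : ℂ)
        = Real.fourierChar (-⟪z, ω⟫) * Real.fourierChar (-⟪z - t, -ω⟫) := by
      rw [← Circle.coe_mul, ← AddChar.map_add_eq_mul]
      congr 2
      simp only [inner_sub_left, inner_neg_right]; ring
    rw [h1, gauss_neg, Circle.smul_def, Circle.smul_def, smul_eq_mul, smul_eq_mul, h2]
    ring
  rw [this, norm_mul, Circle.norm_coe, one_mul]

lemma aestronglyMeasurable_stft {f : V → ℂ} (hf : Integrable f) :
    AEStronglyMeasurable (fun z : V × V => stft (gauss V) f z.1 z.2) := by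
  unfold stft
  simp only [Real.fourier_eq]
  apply AEStronglyMeasurable.integral_prod_right'
    (f := fun p : (V × V) × V => Real.fourierChar (-⟪p.2, p.1.2⟫) •
      (f p.2 * conj (gauss V (p.2 - p.1.1))))
  apply AEStronglyMeasurable.smul
  · apply Continuous.aestronglyMeasurable
    have : Continuous fun p : (V × V) × V => -⟪p.2, p.1.2⟫ :=
      (continuous_snd.inner (continuous_snd.comp continuous_fst)).neg
    exact continuous_subtype_val.comp (Real.continuous_fourierChar.comp this)
  · apply AEStronglyMeasurable.mul
    · exact hf.aestronglyMeasurable.comp_snd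
    · apply Continuous.aestronglyMeasurable
      exact Complex.continuous_conj.comp (continuous_gauss.comp (by fun_prop))

lemma measurePreserving_neg_swap :
    MeasurePreserving (fun z : V × V => (-z.2, z.1)) volume volume := by
  have h1 : MeasurePreserving (Prod.swap : V × V → V × V) volume volume :=
    Measure.measurePreserving_swap
  have h2 : MeasurePreserving (Prod.map (fun x : V => -x) (id : V → V))
      ((volume : Measure V).prod (volume : Measure V)) (volume.prod volume) :=
    (Measure.measurePreserving_neg (volume : Measure V)).prod (MeasurePreserving.id _)
  exact h2.comp h1

lemma measurePreserving_sub_neg (x : V) :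
    MeasurePreserving (fun z : V × V => (x - z.1, -z.2)) volume volume :=
  (Measure.measurePreserving_sub_left (volume : Measure V) x).prod
    (Measure.measurePreserving_neg (volume : Measure V))

lemma MemFeichtinger.comp_sub {f : V → ℂ} (hf : MemFeichtinger f) (z : V) :
    MemFeichtinger (fun t => f (z - t)) := by
  obtain ⟨h1, h2, h3⟩ := hf
  have h2' : Integrable (fun t => f (z - t)) := h2.comp_sub_left z
  refine ⟨by fun_prop, h2', ?_⟩
  rw [← integrable_norm_iff (aestronglyMeasurable_stft h2')]
  simp_rw [stft_comp_sub]
  exact ((measurePreserving_sub_neg z).integrable_comp_of_integrable h3).norm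

lemma stft_fourier {f : V → ℂ} (hf : Integrable f) (x ω : V) :
    ‖stft (gauss V) (𝓕 f) x ω‖ = ‖stft (gauss V) f (-ω) x‖ := by
  set H : V → ℂ := fun t => Real.fourierChar (-⟪t, ω⟫) • gauss V (t - x) with hH
  have hHi : Integrable H :=
    (Real.fourierIntegral_convergent_iff ω).2 (integrable_gauss.comp_sub_right x)
  have hHF : ∀ s, 𝓕 H s = (Real.fourierChar (-⟪x, s + ω⟫) : ℂ) * gauss V (s + ω) := by
    intro s
    rw [← fourier_gauss (s + ω), Real.fourier_eq, Real.fourier_eq, ← integral_const_mul,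
      ← integral_sub_right_eq_self (fun u => (Real.fourierChar (-⟪x, s + ω⟫) : ℂ) *
        (Real.fourierChar (-⟪u, s + ω⟫) • gauss V u)) x]
    congr 1; ext t
    have h2 : (Real.fourierChar (-⟪t, s⟫) : ℂ) * Real.fourierChar (-⟪t, ω⟫)
        = Real.fourierChar (-⟪x, s + ω⟫) * Real.fourierChar (-⟪t - x, s + ω⟫) := by
      rw [← Circle.coe_mul, ← Circle.coe_mul, ← AddChar.map_add_eq_mul,
        ← AddChar.map_add_eq_mul]
      congr 2
      simp only [inner_sub_left, inner_add_right]; ring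
    simp only [hH, Circle.smul_def, smul_eq_mul]
    rw [← mul_assoc, ← mul_assoc, h2]
  have key : ∫ t, 𝓕 f t • H t = ∫ s, f s • 𝓕 H s := by
    simpa using! (VectorFourier.integral_fourierIntegral_smul_eq_flip (L := innerₗ V)
      Real.continuous_fourierChar continuous_inner hf hHi)
  have e1 : stft (gauss V) (𝓕 f) x ω = ∫ t, 𝓕 f t • H t := by
    unfold stft
    rw [Real.fourier_eq]
    congr 1; ext t
    simp only [hH, Circle.smul_def, smul_eq_mul, conj_gauss]
    ring
  have e2 : ∫ s, f s • 𝓕 H s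
      = (Real.fourierChar (-⟪x, ω⟫) : ℂ) * stft (gauss V) f (-ω) x := by
    unfold stft
    rw [Real.fourier_eq, ← integral_const_mul]
    congr 1; ext s
    have h2 : (Real.fourierChar (-⟪x, s + ω⟫) : ℂ)
        = Real.fourierChar (-⟪x, ω⟫) * Real.fourierChar (-⟪s, x⟫) := by
      rw [← Circle.coe_mul, ← AddChar.map_add_eq_mul]
      congr 2
      rw [inner_add_right, real_inner_comm x s]; ring
    simp only [hHF, h2, Circle.smul_def, smul_eq_mul, conj_gauss, sub_neg_eq_add]
    ring
  rw [e1, key, e2, norm_mul, Circle.norm_coe, one_mul]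

/-- Integrating the short-time Fourier transform over the position variable. -/
lemma integral_stft_left {f : V → ℂ} (hf : Integrable f) (ω : V) :
    ∫ x, stft (gauss V) f x ω = 𝓕 f ω := by
  have hg1 : ∫ u, gauss V u = 1 := by
    have := fourier_gauss (0 : V)
    simpa [Real.fourier_eq, gauss] using! this
  unfold stft
  simp only [Real.fourier_eq]
  rw [integral_integral_swap]
  · congr 1; ext t
    simp only [Circle.smul_def, smul_eq_mul, conj_gauss]
    rw [integral_const_mul, integral_const_mul, integral_sub_left_eq_self (gauss V) volume t, hg1,
      mul_one]
  · have h3 : Integrable (fun p : V × V => f p.2 * gauss V (p.1 - p.2))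
        (volume.prod volume) :=
      hf.convolution_integrand (ContinuousLinearMap.mul ℂ ℂ) integrable_gauss
    refine (integrable_norm_iff ?_).1 ?_
    · apply AEStronglyMeasurable.smul
      · apply Continuous.aestronglyMeasurable
        have : Continuous fun p : V × V => -⟪p.2, ω⟫ :=
          (continuous_snd.inner continuous_const).neg
        exact continuous_subtype_val.comp (Real.continuous_fourierChar.comp this)
      · apply AEStronglyMeasurable.mul
        · exact hf.aestronglyMeasurable.comp_snd
        · apply Continuous.aestronglyMeasurable
          exact Complex.continuous_conj.comp (continuous_gauss.comp (by fun_prop))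
    · convert! h3.norm using 2 with p
      simp only [Function.uncurry, Circle.norm_smul, conj_gauss]
      rw [← gauss_neg, neg_sub]

/-- The Fourier transform of an element of `S₀` is integrable. -/
lemma MemFeichtinger.integrable_fourier {f : V → ℂ} (hf : MemFeichtinger f) :
    Integrable (𝓕 f) := by
  have h := hf.2.2.integral_prod_right
  simp only [integral_stft_left hf.2.1] at h
  exact h

lemma MemFeichtinger.fourier {f : V → ℂ} (hf : MemFeichtinger f) : MemFeichtinger (𝓕 f) := by
  have h := hf.integrable_fourier
  refine ⟨VectorFourier.fourierIntegral_continuous Real.continuous_fourierChar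
    continuous_inner hf.2.1, h, ?_⟩
  rw [← integrable_norm_iff (aestronglyMeasurable_stft h)]
  simp_rw [stft_fourier hf.2.1]
  exact (measurePreserving_neg_swap.integrable_comp_of_integrable hf.2.2).norm

lemma feichtingerNorm_fourier {f : V → ℂ} (hf : MemFeichtinger f) :
    feichtingerNorm (𝓕 f) = feichtingerNorm f := by
  unfold feichtingerNorm
  simp_rw [stft_fourier hf.2.1]
  have he : MeasurableEmbedding (fun z : V × V => (-z.2, z.1)) :=
    ((Homeomorph.prodComm V V).trans
      ((Homeomorph.neg V).prodCongr (Homeomorph.refl V))).measurableEmbedding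
  exact measurePreserving_neg_swap.integral_comp he
    (fun z : V × V => ‖stft (gauss V) f z.1 z.2‖)

/-- `M¹` embeds continuously in `L¹`. -/
lemma MemFeichtinger.integral_norm_le {f : V → ℂ} (hf : MemFeichtinger f) :
    ∫ t, ‖f t‖ ≤ feichtingerNorm f := by
  unfold feichtingerNorm
  rw [Measure.volume_eq_prod, integral_prod _ hf.2.2.norm]
  apply integral_mono_ae hf.2.1.norm hf.2.2.norm.integral_prod_left
  filter_upwards [hf.2.2.prod_right_ae] with x hx
  have hc : Continuous (fun t : V => f t * conj (gauss V (t - x))) :=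
    hf.1.mul (Complex.continuous_conj.comp (continuous_gauss.comp (by fun_prop)))
  have hinv := congrFun (hc.fourierInv_fourier_eq (integrable_mul_gauss hf.2.1 x) hx) x
  have h0 : conj (gauss V (x - x)) = 1 := by simp [gauss]
  simp only [h0, mul_one] at hinv
  rw [← hinv, Real.fourierInv_eq]
  refine (norm_integral_le_integral_norm _).trans (le_of_eq ?_)
  simp [Circle.norm_smul, stft]

/-! ### The dual space `S₀'` -/

variable (V) in
/-- The dual `S₀' = M^∞` of the Feichtinger algebra: the linear functionals on `S₀` that are
bounded for the norm of `M¹`. -/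
def FeichtingerDual : Submodule ℂ (Feichtinger V →ₗ[ℂ] ℂ) where
  carrier := {θ | ∃ C : ℝ, ∀ F : Feichtinger V, ‖θ F‖ ≤ C * feichtingerNorm (F : V → ℂ)}
  zero_mem' := ⟨0, fun F => by simp⟩
  add_mem' := by
    rintro θ₁ θ₂ ⟨C₁, h₁⟩ ⟨C₂, h₂⟩
    refine ⟨C₁ + C₂, fun F => ?_⟩
    rw [add_mul]
    exact (norm_add_le _ _).trans (add_le_add (h₁ F) (h₂ F))
  smul_mem' := by
    rintro c θ ⟨C, h⟩
    refine ⟨‖c‖ * C, fun F => ?_⟩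
    rw [mul_assoc, LinearMap.smul_apply, norm_smul]
    exact mul_le_mul_of_nonneg_left (h F) (norm_nonneg c)

/-- The Fourier transform on `S₀`. -/
def fourierFeichtinger : Feichtinger V →ₗ[ℂ] Feichtinger V where
  toFun F := ⟨𝓕 (F : V → ℂ), MemFeichtinger.fourier F.2⟩
  map_add' F G := by
    ext ω
    simp only [Submodule.coe_add, Pi.add_apply, Real.fourier_eq]
    rw [← integral_add ((Real.fourierIntegral_convergent_iff ω).2 F.2.2.1)
      ((Real.fourierIntegral_convergent_iff ω).2 G.2.2.1)]
    simp [smul_add]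
  map_smul' c F := by
    ext ω
    simp only [Submodule.coe_smul, Pi.smul_apply, RingHom.id_apply, Real.fourier_eq]
    rw [← integral_smul]
    congr 1; ext t
    rw [smul_comm]

/-- The Fourier transform on `S₀'`, defined by `⟨𝓕 θ, F⟩ = ⟨θ, 𝓕 F⟩`. -/
def FeichtingerDual.fourier (θ : FeichtingerDual V) : FeichtingerDual V :=
  ⟨θ.1 ∘ₗ fourierFeichtinger, by
    obtain ⟨C, h⟩ := θ.2
    refine ⟨C, fun F => ?_⟩
    have := h (fourierFeichtinger F)
    rwa [show ((fourierFeichtinger F : Feichtinger V) : V → ℂ) = 𝓕 (F : V → ℂ) from rfl,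
      feichtingerNorm_fourier F.2] at this⟩

/-- The element `F ↦ ∫ h F` of `S₀'` given by a bounded continuous function `h`. -/
def FeichtingerDual.ofFun (h : V →ᵇ ℂ) : FeichtingerDual V :=
  ⟨{ toFun := fun F => ∫ z, h z * (F : V → ℂ) z
     map_add' := fun F G => by
      have hi : ∀ F : Feichtinger V, Integrable fun z => h z * (F : V → ℂ) z := fun F =>
        F.2.2.1.bdd_mul h.continuous.aestronglyMeasurable
          (Filter.Eventually.of_forall h.norm_coe_le_norm)
      rw [← integral_add (hi F) (hi G)]
      simp [mul_add]
     map_smul' := fun c F => by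
      rw [RingHom.id_apply, smul_eq_mul, ← integral_const_mul]
      congr 1; ext z
      simp only [Submodule.coe_smul, Pi.smul_apply, smul_eq_mul]
      ring },
    ‖h‖, fun F => by
      refine (norm_integral_le_integral_norm _).trans ?_
      refine le_trans ?_ (mul_le_mul_of_nonneg_left (MemFeichtinger.integral_norm_le F.2)
        (norm_nonneg h))
      rw [← integral_const_mul]
      refine integral_mono_of_nonneg (Filter.Eventually.of_forall fun z => norm_nonneg _)
        (F.2.2.1.norm.const_mul _) (Filter.Eventually.of_forall fun z => ?_)
      dsimp only
      rw [norm_mul]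
      exact mul_le_mul_of_nonneg_right (h.norm_coe_le_norm z) (norm_nonneg _)⟩

/-- The convolution of `F ∈ S₀` with `θ ∈ S₀'`: `(F * θ)(z) = ⟨θ, F(z - ·)⟩`. -/
def convFeichtinger (F : Feichtinger V) (θ : FeichtingerDual V) (z : V) : ℂ :=
  θ.1 ⟨fun w => (F : V → ℂ) (z - w), MemFeichtinger.comp_sub F.2 z⟩

/-! ### Tempered distributions -/

/-- The convolution of a Schwartz function `F` with a tempered distribution `θ`:
`(F * θ)(z) = ⟨θ, F(z - ·)⟩`. -/
def convTempered (F : 𝓢(V, ℂ)) (θ : 𝓢'(V, ℂ)) (z : V) : ℂ :=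
  θ ((compCLMOfContinuousLinearEquiv ℂ (ContinuousLinearEquiv.neg ℝ (M := V)) F).compSubConstCLM
    ℂ z)

lemma convTempered_arg (F : 𝓢(V, ℂ)) (z w : V) :
    ((compCLMOfContinuousLinearEquiv ℂ (ContinuousLinearEquiv.neg ℝ (M := V)) F).compSubConstCLM
      ℂ z) w = F (z - w) := by
  simp

/-- The tempered distribution `φ ↦ ∫ h φ` given by a bounded continuous function `h`. -/
def temperedOfFun (h : V →ᵇ ℂ) : 𝓢'(V, ℂ) :=
  Lp.toTemperedDistribution (p := ⊤) (μ := volume)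
    ((memLp_top_of_bound h.continuous.aestronglyMeasurable ‖h‖
      (Filter.Eventually.of_forall h.norm_coe_le_norm)).toLp)

end General

/-! ### Matrix-Wigner distributions and Cohen's class -/

section Wigner

variable {d : ℕ}

/-- `ℝ^d`. -/
abbrev Space (d : ℕ) : Type := EuclideanSpace ℝ (Fin d)

/-- `ℝ^{2d}`, whose elements are pairs `(x, ω)` of vectors of `ℝ^d`. -/
abbrev Phase (d : ℕ) : Type := EuclideanSpace ℝ (Fin d ⊕ Fin d)

/-- The first component `x` of `z = (x, ω) ∈ ℝ^{2d}`. -/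
def Phase.pos (z : Phase d) : Space d := WithLp.toLp 2 fun i => z (Sum.inl i)

/-- The second component `ω` of `z = (x, ω) ∈ ℝ^{2d}`. -/
def Phase.freq (z : Phase d) : Space d := WithLp.toLp 2 fun i => z (Sum.inr i)

lemma Phase.continuous_pos : Continuous (Phase.pos : Phase d → Space d) := by
  unfold Phase.pos; fun_prop

lemma Phase.continuous_freq : Continuous (Phase.freq : Phase d → Space d) := by
  unfold Phase.freq; fun_prop

/-- The matrix-Wigner distribution
`B_A(f, g)(x, ω) = ∫ exp(-2πi ω·y) f(A₁₁ x + A₁₂ y) conj(g(A₂₁ x + A₂₂ y)) dy`. -/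
def matrixWigner (A : Matrix (Fin d ⊕ Fin d) (Fin d ⊕ Fin d) ℝ) (f g : Space d → ℂ)
    (z : Phase d) : ℂ :=
  ∫ y : Space d, Complex.exp (-2 * Real.pi * Complex.I * (⟪z.freq, y⟫ : ℝ)) *
    (f (A.toBlocks₁₁.toEuclideanLin z.pos + A.toBlocks₁₂.toEuclideanLin y) *
      conj (g (A.toBlocks₂₁.toEuclideanLin z.pos + A.toBlocks₂₂.toEuclideanLin y)))

/-- The cross-Wigner distribution
`W(f, g)(x, ω) = ∫ exp(-2πi ω·y) f(x + y/2) conj(g(x - y/2)) dy`. -/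
def wigner (f g : Space d → ℂ) (z : Phase d) : ℂ :=
  ∫ y : Space d, Complex.exp (-2 * Real.pi * Complex.I * (⟪z.freq, y⟫ : ℝ)) *
    (f (z.pos + (1 / 2 : ℝ) • y) * conj (g (z.pos - (1 / 2 : ℝ) • y)))

/-- The tempered distribution `θ` on `ℝ^{2d}` is a Cohen kernel of the time-frequency distribution
`Q`: for Schwartz functions `f, g`, the function `W(f, g)` is a Schwartz function and
`Q(f, g) = W(f, g) * θ`. -/
def IsCohenKernel (Q : (Space d → ℂ) → (Space d → ℂ) → Phase d → ℂ) (θ : 𝓢'(Phase d, ℂ)) : Prop :=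
  ∀ f g : 𝓢(Space d, ℂ), ∃ F : 𝓢(Phase d, ℂ),
    (∀ z, F z = wigner f g z) ∧ ∀ z, Q f g z = convTempered F θ z

/-- Cohen's class. -/
def InCohenClass (Q : (Space d → ℂ) → (Space d → ℂ) → Phase d → ℂ) : Prop :=
  ∃ θ : 𝓢'(Phase d, ℂ), IsCohenKernel Q θ

/-- The matrix `A_M = [[I, M + I/2], [I, M - I/2]]`. -/
def cohenMatrix (M : Matrix (Fin d) (Fin d) ℝ) : Matrix (Fin d ⊕ Fin d) (Fin d ⊕ Fin d) ℝ :=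
  Matrix.fromBlocks 1 (M + (1 / 2 : ℝ) • 1) 1 (M - (1 / 2 : ℝ) • 1)

/-- The chirp `Θ_M(ξ, η) = exp(-2πi ξ·Mη)` on `ℝ^{2d}`. -/
def chirp (M : Matrix (Fin d) (Fin d) ℝ) : Phase d →ᵇ ℂ :=
  BoundedContinuousFunction.ofNormedAddCommGroup
    (fun ζ => Complex.exp (-2 * Real.pi * Complex.I *
      (⟪ζ.pos, M.toEuclideanLin ζ.freq⟫ : ℝ)))
    (by
      have h := Phase.continuous_pos.inner (𝕜 := ℝ)
        ((LinearMap.continuous_of_finiteDimensional M.toEuclideanLin).comp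
          (Phase.continuous_freq (d := d)))
      exact Complex.continuous_exp.comp
        (continuous_const.mul (Complex.continuous_ofReal.comp h)))
    1 (fun ζ => by
      rw [Complex.norm_exp]
      simp)

/-- The function `(x, ω) ↦ |det M|⁻¹ exp(2πi ω·M⁻¹x)` on `ℝ^{2d}`. -/
def explicitKernel (M : Matrix (Fin d) (Fin d) ℝ) : Phase d →ᵇ ℂ :=
  BoundedContinuousFunction.ofNormedAddCommGroup
    (fun z => ((|M.det|⁻¹ : ℝ) : ℂ) * Complex.exp (2 * Real.pi * Complex.I *
      (⟪z.freq, M⁻¹.toEuclideanLin z.pos⟫ : ℝ)))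
    (by
      have h := Phase.continuous_freq.inner (𝕜 := ℝ)
        ((LinearMap.continuous_of_finiteDimensional M⁻¹.toEuclideanLin).comp
          (Phase.continuous_pos (d := d)))
      exact continuous_const.mul (Complex.continuous_exp.comp
        (continuous_const.mul (Complex.continuous_ofReal.comp h))))
    |M.det|⁻¹ (fun z => by
      rw [norm_mul, Complex.norm_exp, Complex.norm_real]
      simp)

/-- The Cohen kernel `θ_M = 𝓕 Θ_M ∈ S₀'(ℝ^{2d})`. -/
def cohenKernel (M : Matrix (Fin d) (Fin d) ℝ) : FeichtingerDual (Phase d) :=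
  FeichtingerDual.fourier (FeichtingerDual.ofFun (chirp M))

end Wigner

end TimeFreq
end

open TimeFreq

/-! Sufficiency: `W(f,g)` is the Fourier transform in `y` of `F(x,y) = f(x+y/2) conj g(x-y/2)`. By
inversion in that variable, its full Fourier transform at `(ξ,η)` is the Fourier transform of
`F(·,-η)` at `ξ`. There `Θ_M` acts as a modulation in `ξ` with frequency linear in `η`, so undoing
the transform shears `F` into `F(x+My,y)`, which is the integrand of `W_M`. Hence `W_M(f,g)(z) = ∫
Θ_M · 𝓕[W(f,g)(z-·)]` (`integral_chirp_mul_fourier`, `matrixWigner_cohenMatrix_eq_integral`), and by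
duality this is `W(f,g) * 𝓕Θ_M`.

The computation uses little beyond integrability of `W(f,g)` and of its Fourier transform, so it
serves both settings. It remains that `W(f,g)` is Schwartz for Schwartz `f, g`
(`exists_schwartz_eq_wigner`) and lies in `S₀` for `f, g` in `S₀` (`MemFeichtinger.wigner`). In the
latter case the window `exp(-2π|z|²)`, a multiple of the Wigner distribution of the standard
Gaussian, makes the short-time Fourier transform of `W(f,g)` factor into those of `f` and `g`. The
standard window is then recovered by averaging.

Necessity: `W` is covariant under time-frequency shifts and convolution commutes with translations,
so all of Cohen's class is covariant (`InCohenClass.covariant`). Injectivity of the Fourier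
transform turns this into a pointwise identity between integrands (`InCohenClass.matrixPair_eq`).
Tested on one bump function, it forces `A₁₁ = A₂₁ = I` and `A₁₂ - A₂₂ = I`.

Explicit kernel: the chirp is damped by a wide Gaussian, its Fourier transform is computed, and the
damping is removed by dominated convergence on both sides of Parseval's formula. -/

noncomputable section

namespace TimeFreq

/-! ### Coordinates on `ℝ^{2d}` and Wigner distributions as Fourier transforms -/

section PhaseCoordinates

variable {d : ℕ}

/-- The point `(x, ω)` of `ℝ^{2d}`. -/
def Phase.mk (x ω : Space d) : Phase d := WithLp.toLp 2 (Sum.elim x ω)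

@[simp] lemma Phase.pos_mk (x ω : Space d) : (Phase.mk x ω).pos = x := rfl

@[simp] lemma Phase.freq_mk (x ω : Space d) : (Phase.mk x ω).freq = ω := rfl

@[simp] lemma Phase.mk_pos_freq (z : Phase d) : Phase.mk z.pos z.freq = z := by
  ext i; rcases i with i | i <;> rfl

@[simp] lemma Phase.pos_add (z w : Phase d) : (z + w).pos = z.pos + w.pos := rfl
@[simp] lemma Phase.freq_add (z w : Phase d) : (z + w).freq = z.freq + w.freq := rfl
@[simp] lemma Phase.pos_sub (z w : Phase d) : (z - w).pos = z.pos - w.pos := rfl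
@[simp] lemma Phase.freq_sub (z w : Phase d) : (z - w).freq = z.freq - w.freq := rfl
@[simp] lemma Phase.pos_neg (z : Phase d) : (-z).pos = -z.pos := rfl
@[simp] lemma Phase.freq_neg (z : Phase d) : (-z).freq = -z.freq := rfl
@[simp] lemma Phase.pos_smul (c : ℝ) (z : Phase d) : (c • z).pos = c • z.pos := rfl
@[simp] lemma Phase.freq_smul (c : ℝ) (z : Phase d) : (c • z).freq = c • z.freq := rfl

lemma Phase.ext' {z w : Phase d} (h₁ : z.pos = w.pos) (h₂ : z.freq = w.freq) : z = w := by
  rw [← z.mk_pos_freq, ← w.mk_pos_freq, h₁, h₂]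

lemma Phase.inner_eq (z w : Phase d) : ⟪z, w⟫ = ⟪z.pos, w.pos⟫ + ⟪z.freq, w.freq⟫ := by
  simp [PiLp.inner_apply, Phase.pos, Phase.freq]

lemma Phase.norm_sq_eq (z : Phase d) : ‖z‖ ^ 2 = ‖z.pos‖ ^ 2 + ‖z.freq‖ ^ 2 := by
  rw [← real_inner_self_eq_norm_sq, Phase.inner_eq, real_inner_self_eq_norm_sq,
    real_inner_self_eq_norm_sq]

/-- The linear identification of `ℝ^{2d}` with `ℝ^d × ℝ^d`. -/
def Phase.equivProd : Phase d ≃L[ℝ] Space d × Space d :=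
  LinearEquiv.toContinuousLinearEquiv
    { toFun := fun z => (z.pos, z.freq)
      map_add' := fun _ _ => rfl
      map_smul' := fun _ _ => rfl
      invFun := fun p => Phase.mk p.1 p.2
      left_inv := fun z => z.mk_pos_freq
      right_inv := fun _ => rfl }

@[simp] lemma Phase.equivProd_apply (z : Phase d) : Phase.equivProd z = (z.pos, z.freq) := rfl

@[simp] lemma Phase.equivProd_symm_apply (p : Space d × Space d) :
    Phase.equivProd.symm p = Phase.mk p.1 p.2 := rfl

lemma Phase.measurableEmbedding_mk :
    MeasurableEmbedding fun p : Space d × Space d => Phase.mk p.1 p.2 :=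
  Phase.equivProd.symm.toHomeomorph.measurableEmbedding

lemma Phase.measurePreserving_mk :
    MeasurePreserving (fun p : Space d × Space d => Phase.mk p.1 p.2) volume volume := by
  have h1 : MeasurePreserving (fun p : Space d × Space d => ((p.1 : Fin d → ℝ), (p.2 : Fin d → ℝ)))
      volume volume :=
    (PiLp.volume_preserving_ofLp (Fin d)).prod (PiLp.volume_preserving_ofLp (Fin d))
  have h2 := (volume_measurePreserving_sumPiEquivProdPi_symm
    (fun _ : Fin d ⊕ Fin d => ℝ)).comp h1
  have h3 := (PiLp.volume_preserving_toLp (Fin d ⊕ Fin d)).comp h2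
  convert! h3 using 1

lemma Phase.integral_eq {E : Type*} [NormedAddCommGroup E] [NormedSpace ℝ E] (h : Phase d → E) :
    ∫ z, h z = ∫ p : Space d × Space d, h (Phase.mk p.1 p.2) :=
  (Phase.measurePreserving_mk.integral_comp Phase.measurableEmbedding_mk h).symm

lemma Phase.integrable_iff {E : Type*} [NormedAddCommGroup E] (h : Phase d → E) :
    Integrable h ↔ Integrable fun p : Space d × Space d => h (Phase.mk p.1 p.2) :=
  (Phase.measurePreserving_mk.integrable_comp_emb Phase.measurableEmbedding_mk).symm

lemma wigner_eq_fourier (f g : Space d → ℂ) (z : Phase d) :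
    wigner f g z
      = 𝓕 (fun y => f (z.pos + (1 / 2 : ℝ) • y) * conj (g (z.pos - (1 / 2 : ℝ) • y))) z.freq := by
  rw [Real.fourier_eq']
  unfold wigner
  congr 1; ext y
  rw [smul_eq_mul, real_inner_comm]
  congr 2
  push_cast; ring

lemma matrixWigner_eq_fourier (A : Matrix (Fin d ⊕ Fin d) (Fin d ⊕ Fin d) ℝ) (f g : Space d → ℂ)
    (z : Phase d) :
    matrixWigner A f g z
      = 𝓕 (fun y => f (A.toBlocks₁₁.toEuclideanLin z.pos + A.toBlocks₁₂.toEuclideanLin y) *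
          conj (g (A.toBlocks₂₁.toEuclideanLin z.pos + A.toBlocks₂₂.toEuclideanLin y)))
          z.freq := by
  rw [Real.fourier_eq']
  unfold matrixWigner
  congr 1; ext y
  rw [smul_eq_mul, real_inner_comm]
  congr 2
  push_cast; ring

lemma matrixWigner_cohenMatrix (M : Matrix (Fin d) (Fin d) ℝ) (f g : Space d → ℂ)
    (z : Phase d) :
    matrixWigner (cohenMatrix M) f g z
      = 𝓕 (fun y => f (z.pos + M.toEuclideanLin y + (1 / 2 : ℝ) • y) *
          conj (g (z.pos + M.toEuclideanLin y - (1 / 2 : ℝ) • y))) z.freq := by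
  rw [matrixWigner_eq_fourier]
  refine congrArg (fun F : Space d → ℂ => 𝓕 F z.freq) (funext fun y => ?_)
  simp [cohenMatrix, add_assoc, Matrix.toLpLin_one, add_sub_assoc]

end PhaseCoordinates

/-! ### Partial Fourier transforms: chirp multipliers act as shears -/

section PartialFourier

variable {d : ℕ}

lemma fourierChar_coe_add (a b : ℝ) :
    (Real.fourierChar (a + b) : ℂ) = Real.fourierChar a * Real.fourierChar b := by
  rw [AddChar.map_add_eq_mul, Circle.coe_mul]

/-- The Fourier transform of a reflected and translated function. -/
lemma fourier_comp_sub_left {V : Type*} [NormedAddCommGroup V] [InnerProductSpace ℝ V]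
    [FiniteDimensional ℝ V] [MeasurableSpace V] [BorelSpace V] (H : V → ℂ) (z ζ : V) :
    𝓕 (fun w => H (z - w)) ζ = Real.fourierChar (-⟪z, ζ⟫) * 𝓕 H (-ζ) := by
  simp only [Real.fourier_eq]
  rw [← integral_const_mul, ← integral_sub_left_eq_self (fun t =>
    (Real.fourierChar (-⟪z, ζ⟫) : ℂ) * (Real.fourierChar (-⟪t, -ζ⟫) • H t)) volume z]
  refine integral_congr_ae (Filter.Eventually.of_forall fun t => ?_)
  simp only [Circle.smul_def, smul_eq_mul]
  rw [← mul_assoc, ← fourierChar_coe_add]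
  congr 3
  simp only [inner_sub_left, inner_neg_right]; ring

/-- Transforming twice in the second variable is a reflection. Integrability of `W` gives, by
Fubini, integrability of `𝓕 (F x)` for almost every `x`, which is enough for inversion on the
fibres; continuity of `F x` makes inversion hold at the single point `-η`. -/
lemma fourier_mk_eq {W : Phase d → ℂ} {F : Space d → Space d → ℂ}
    (hc : ∀ x, Continuous (F x)) (hi : ∀ x, Integrable (F x))
    (hW : ∀ x ω, W (Phase.mk x ω) = 𝓕 (F x) ω) (hWi : Integrable W) (ξ η : Space d) :
    𝓕 W (Phase.mk ξ η) = 𝓕 (fun x => F x (-η)) ξ := by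
  rw [Real.fourier_eq, Phase.integral_eq]
  have hi' := (Phase.integrable_iff _).1
    ((Real.fourierIntegral_convergent_iff (Phase.mk ξ η)).2 hWi)
  rw [Measure.volume_eq_prod] at hi' ⊢
  rw [integral_prod _ hi', Real.fourier_eq]
  have hWi' := (Phase.integrable_iff W).1 hWi
  rw [Measure.volume_eq_prod] at hWi'
  refine integral_congr_ae ?_
  filter_upwards [hWi'.prod_right_ae] with x hx
  simp only [hW] at hx
  have hinv := congrFun ((hc x).fourierInv_fourier_eq (hi x) hx) (-η)
  rw [← hinv, Real.fourierInv_eq, Circle.smul_def, smul_eq_mul, ← integral_const_mul]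
  congr 1; ext ω
  simp only [Circle.smul_def, smul_eq_mul, hW, Phase.inner_eq, Phase.pos_mk, Phase.freq_mk]
  rw [← mul_assoc, ← fourierChar_coe_add]
  congr 3
  rw [inner_neg_right]; ring

lemma chirp_apply (M : Matrix (Fin d) (Fin d) ℝ) (ζ : Phase d) :
    chirp M ζ = Real.fourierChar (-⟪ζ.pos, M.toEuclideanLin ζ.freq⟫) := by
  rw [Real.fourierChar_apply]
  change Complex.exp _ = _
  congr 1; push_cast; ring

/-- Multiplying the Fourier transform of `W` by a chirp amounts, for `W` the Fourier transform of
`F` in the second variable, to a shear of `F`. -/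
lemma integral_chirp_mul_fourier {W : Phase d → ℂ} {F : Space d → Space d → ℂ}
    (hc : ∀ x, Continuous (F x)) (hi : ∀ x, Integrable (F x))
    (hc' : ∀ y, Continuous fun x => F x y) (hi' : ∀ y, Integrable fun x => F x y)
    (hW : ∀ x ω, W (Phase.mk x ω) = 𝓕 (F x) ω) (hWi : Integrable W) (hWf : Integrable (𝓕 W))
    (M : Matrix (Fin d) (Fin d) ℝ) (z : Phase d) :
    ∫ ζ, chirp M ζ * 𝓕 (fun w => W (z - w)) ζ
      = 𝓕 (fun y => F (z.pos + M.toEuclideanLin y) y) z.freq := by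
  have e1 : ∫ ζ, chirp M ζ * 𝓕 (fun w => W (z - w)) ζ
      = ∫ ζ : Phase d, (Real.fourierChar (⟪z, ζ⟫ - ⟪ζ.pos, M.toEuclideanLin ζ.freq⟫) : ℂ)
          * 𝓕 W ζ := by
    -- The chirp has a quadratic phase, hence is even and unaffected by `ζ ↦ -ζ`.
    rw [← integral_neg_eq_self]
    congr 1; ext ζ
    rw [fourier_comp_sub_left, chirp_apply, ← mul_assoc, ← fourierChar_coe_add, neg_neg]
    congr 3
    simp; ring
  have hint : Integrable fun ζ : Phase d =>
      (Real.fourierChar (⟪z, ζ⟫ - ⟪ζ.pos, M.toEuclideanLin ζ.freq⟫) : ℂ) * 𝓕 W ζ := by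
    refine hWf.bdd_mul (c := 1) ?_ (Filter.Eventually.of_forall fun ζ => (Circle.norm_coe _).le)
    refine (continuous_subtype_val.comp (Real.continuous_fourierChar.comp ?_)).aestronglyMeasurable
    exact (continuous_const.inner continuous_id).sub
      (Phase.continuous_pos.inner ((LinearMap.continuous_of_finiteDimensional _).comp
        Phase.continuous_freq))
  have hint' := (Phase.integrable_iff _).1 hint
  have hWf' := (Phase.integrable_iff _).1 hWf
  rw [e1, Phase.integral_eq]
  rw [Measure.volume_eq_prod] at hint' hWf' ⊢
  -- The variable `ξ` is integrated first: there the chirp only moves the inversion point to `z.pos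
  -- - Mη`. The reflection `η = -y` then produces `F (z.pos + My) y`.
  rw [integral_prod_symm _ hint', Real.fourier_eq, ← integral_neg_eq_self]
  refine integral_congr_ae ?_
  have hq : Measure.QuasiMeasurePreserving (fun y : Space d => -y) volume volume :=
    (Measure.measurePreserving_neg (volume : Measure (Space d))).quasiMeasurePreserving
  filter_upwards [hq.ae hWf'.prod_left_ae] with y hy
  simp only [fourier_mk_eq hc hi hW hWi, neg_neg] at hy ⊢
  have hinv := congrFun ((hc' y).fourierInv_fourier_eq (hi' y) hy)
    (z.pos + M.toEuclideanLin y)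
  rw [← hinv, Real.fourierInv_eq, Circle.smul_def, smul_eq_mul, ← integral_const_mul]
  congr 1; ext ξ
  simp only [Circle.smul_def, smul_eq_mul]
  rw [← mul_assoc, ← fourierChar_coe_add]
  congr 3
  simp only [Phase.inner_eq, Phase.pos_mk, Phase.freq_mk, inner_neg_right, map_neg,
    inner_add_right, real_inner_comm]
  ring

end PartialFourier

/-! ### The function `f(x + y/2) conj(g(x - y/2))` -/

section WignerPair

set_option linter.unusedSectionVars false

variable {V : Type*} [NormedAddCommGroup V] [InnerProductSpace ℝ V] [FiniteDimensional ℝ V]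
  [MeasurableSpace V] [BorelSpace V]

/-- The function `(x, y) ↦ f(x + y/2) conj(g(x - y/2))`. -/
def wignerPair (f g : V → ℂ) (x y : V) : ℂ :=
  f (x + (1 / 2 : ℝ) • y) * conj (g (x - (1 / 2 : ℝ) • y))

lemma continuous_wignerPair {f g : V → ℂ} (hf : Continuous f) (hg : Continuous g) :
    Continuous fun p : V × V => wignerPair f g p.1 p.2 := by
  unfold wignerPair
  exact (hf.comp (by fun_prop)).mul (Complex.continuous_conj.comp (hg.comp (by fun_prop)))

lemma integrable_wignerPair_right {f g : V → ℂ} (hf : Integrable f) (hg : Continuous g) {C : ℝ}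
    (hC : ∀ t, ‖g t‖ ≤ C) (x : V) : Integrable (wignerPair f g x) := by
  refine Integrable.mul_bdd (c := C) ?_ ?_
    (Filter.Eventually.of_forall fun y => by simpa using hC _)
  · exact (hf.comp_add_left x).comp_smul (by norm_num : (1 / 2 : ℝ) ≠ 0)
  · exact (Complex.continuous_conj.comp (hg.comp (by fun_prop))).aestronglyMeasurable

lemma integrable_wignerPair_left {f g : V → ℂ} (hf : Integrable f) (hg : Continuous g) {C : ℝ}
    (hC : ∀ t, ‖g t‖ ≤ C) (y : V) : Integrable fun x => wignerPair f g x y := by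
  refine Integrable.mul_bdd (c := C) ?_ ?_
    (Filter.Eventually.of_forall fun y => by simpa using hC _)
  · exact hf.comp_add_right _
  · exact (Complex.continuous_conj.comp (hg.comp (by fun_prop))).aestronglyMeasurable

/-- A composition of swaps with two fibrewise isometries: a translation of `x` by `y/2`, then the
reflection `y ↦ u - y` with `u = x + y/2`. -/
lemma measurePreserving_wignerPair :
    MeasurePreserving (fun p : V × V => (p.1 + (1 / 2 : ℝ) • p.2, p.1 - (1 / 2 : ℝ) • p.2))
      volume volume := by
  have h1 : MeasurePreserving (fun p : V × V => (p.1, p.2 + (1 / 2 : ℝ) • p.1))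
      (volume.prod volume) (volume.prod volume) :=
    (MeasurePreserving.id (volume : Measure V)).skew_product
      (g := fun a b => b + (1 / 2 : ℝ) • a) (by fun_prop)
      (Filter.Eventually.of_forall fun a => (measurePreserving_add_right volume _).map_eq)
  have h2 : MeasurePreserving (fun p : V × V => (p.1, p.1 - p.2))
      (volume.prod volume) (volume.prod volume) :=
    (MeasurePreserving.id (volume : Measure V)).skew_product
      (g := fun a b => a - b) (by fun_prop)
      (Filter.Eventually.of_forall fun a => (Measure.measurePreserving_sub_left volume a).map_eq)
  have hswap : MeasurePreserving (Prod.swap : V × V → V × V) (volume.prod volume)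
      (volume.prod volume) := Measure.measurePreserving_swap
  have h3 := h2.comp (hswap.comp (h1.comp hswap))
  convert! h3 using 1
  ext p
  · rfl
  · simp only [Function.comp, Prod.swap]
    module

end WignerPair

/-- `B_{A_M}(f, g)` is obtained from `W(f, g)` by the Fourier multiplier `Θ_M`. -/
lemma matrixWigner_cohenMatrix_eq_integral {d : ℕ} {f g : Space d → ℂ}
    (hf : Continuous f) (hg : Continuous g) (hfi : Integrable f)
    {C : ℝ} (hC : ∀ t, ‖g t‖ ≤ C) (hWi : Integrable (wigner f g))
    (hWf : Integrable (𝓕 (wigner f g))) (M : Matrix (Fin d) (Fin d) ℝ) (z : Phase d) :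
    matrixWigner (cohenMatrix M) f g z
      = ∫ ζ, chirp M ζ * 𝓕 (fun w => wigner f g (z - w)) ζ := by
  have hcont := continuous_wignerPair hf hg
  rw [integral_chirp_mul_fourier (F := wignerPair f g)
    (fun x => hcont.comp (Continuous.prodMk_right x))
    (fun x => integrable_wignerPair_right hfi hg hC x)
    (fun y => hcont.comp (Continuous.prodMk_left y))
    (fun y => integrable_wignerPair_left hfi hg hC y)
    (fun x ω => wigner_eq_fourier f g _) hWi hWf, matrixWigner_cohenMatrix]
  rfl

/-! ### The window `exp(-2π|t|²)` -/

section NarrowGaussian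

set_option linter.unusedSectionVars false

variable {V : Type*} [NormedAddCommGroup V] [InnerProductSpace ℝ V] [FiniteDimensional ℝ V]
  [MeasurableSpace V] [BorelSpace V]

variable (V) in
/-- The Gaussian window `exp(-2π|t|²)`. -/
def narrowGauss : V → ℂ := fun t => Complex.exp (-(2 * Real.pi : ℂ) * (‖t‖ : ℂ) ^ 2)

lemma narrowGauss_eq_ofReal (t : V) :
    narrowGauss V t = ((Real.exp (-(2 * Real.pi) * ‖t‖ ^ 2) : ℝ) : ℂ) := by
  simp [narrowGauss]

lemma conj_narrowGauss (t : V) : conj (narrowGauss V t) = narrowGauss V t := by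
  rw [narrowGauss_eq_ofReal, Complex.conj_ofReal]

lemma continuous_narrowGauss : Continuous (narrowGauss V) := by
  unfold narrowGauss; fun_prop

lemma norm_narrowGauss_le (t : V) : ‖narrowGauss V t‖ ≤ 1 := by
  rw [narrowGauss_eq_ofReal, Complex.norm_real, Real.norm_of_nonneg (Real.exp_pos _).le]
  apply Real.exp_le_one_iff.2
  have := mul_nonneg Real.pi_pos.le (sq_nonneg ‖t‖)
  linarith

lemma integrable_cexp_neg_mul_sq_norm {b : ℂ} (hb : 0 < b.re) :
    Integrable fun v : V => Complex.exp (-b * (‖v‖ : ℂ) ^ 2) := by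
  have := GaussianFourier.integrable_cexp_neg_mul_sq_norm_add (V := V) hb 0 0
  simpa using this

lemma integrable_narrowGauss : Integrable (narrowGauss V) :=
  integrable_cexp_neg_mul_sq_norm (by simpa using Real.pi_pos)

variable (V) in
/-- The constant `∫ exp(-4π|w|²) dw`. -/
def narrowGaussMass : ℂ := ∫ w : V, Complex.exp (-(4 * Real.pi : ℂ) * (‖w‖ : ℂ) ^ 2)

lemma narrowGaussMass_ne_zero : narrowGaussMass V ≠ 0 := by
  have h := GaussianFourier.integral_cexp_neg_mul_sq_norm (V := V) (b := (4 * Real.pi : ℂ))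
    (by simpa using Real.pi_pos)
  unfold narrowGaussMass
  rw [h]
  have hpi : (Real.pi : ℂ) ≠ 0 := by exact_mod_cast Real.pi_ne_zero
  exact (Complex.cpow_ne_zero_iff.2 (Or.inl (div_ne_zero hpi (mul_ne_zero (by norm_num) hpi))))

/-- The standard Gaussian is a superposition of translates of the narrow one. -/
lemma integral_narrowGauss_mul (u : V) :
    ∫ w : V, narrowGauss V (u - w) * narrowGauss V w = narrowGaussMass V * gauss V u := by
  unfold narrowGaussMass
  rw [← integral_mul_const, ← integral_sub_right_eq_self (fun w : V =>
    Complex.exp (-(4 * Real.pi : ℂ) * (‖w‖ : ℂ) ^ 2) * gauss V u) ((1 / 2 : ℝ) • u)]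
  congr 1; ext w
  unfold narrowGauss gauss
  rw [← Complex.exp_add, ← Complex.exp_add]
  congr 1
  have h : ‖u - w‖ ^ 2 + ‖w‖ ^ 2 = 2 * ‖w - (1 / 2 : ℝ) • u‖ ^ 2 + (1 / 2) * ‖u‖ ^ 2 := by
    rw [norm_sub_sq_real, norm_sub_sq_real, norm_smul, real_inner_smul_right, real_inner_comm]
    norm_num
    ring
  have h' : (‖u - w‖ : ℂ) ^ 2 + (‖w‖ : ℂ) ^ 2
      = 2 * (‖w - (1 / 2 : ℝ) • u‖ : ℂ) ^ 2 + (1 / 2) * (‖u‖ : ℂ) ^ 2 := by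
    have := congrArg (fun r : ℝ => (r : ℂ)) h
    push_cast at this
    exact this
  linear_combination (-(2 * Real.pi : ℂ)) * h'

/-- The Fourier transform of a time-frequency shift of the narrow Gaussian. -/
lemma exists_fourier_narrowGauss_shift : ∃ κ : ℂ, ∀ ω η y : V,
    𝓕 (fun t : V => (Real.fourierChar (-⟪t, η⟫) : ℂ) * narrowGauss V (t - ω)) y
      = κ * ((Real.fourierChar (-⟪ω, η + y⟫) : ℂ) *
          Complex.exp (-(Real.pi / 2 : ℂ) * (‖η + y‖ : ℂ) ^ 2)) := by
  have hb : 0 < (2 * Real.pi : ℂ).re := by simpa using Real.pi_pos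
  -- The normalising factor in the Fourier transform of the Gaussian; only its independence of `ω`,
  -- `η`, `y` matters.
  refine ⟨(Real.pi / (2 * Real.pi) : ℂ) ^ (Module.finrank ℝ V / 2 : ℂ), fun ω η y => ?_⟩
  have h := fourier_gaussian_innerProductSpace (V := V) hb (η + y)
  have hpi : (Real.pi : ℂ) ≠ 0 := by exact_mod_cast Real.pi_ne_zero
  have e : -(Real.pi : ℂ) ^ 2 * (‖η + y‖ : ℂ) ^ 2 / (2 * Real.pi)
      = -(Real.pi / 2 : ℂ) * (‖η + y‖ : ℂ) ^ 2 := by field_simp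
  rw [e] at h
  rw [mul_left_comm, ← h, Real.fourier_eq, Real.fourier_eq, ← integral_const_mul,
    ← integral_sub_right_eq_self (fun t => (Real.fourierChar (-⟪ω, η + y⟫) : ℂ) *
      (Real.fourierChar (-⟪t, η + y⟫) • Complex.exp (-(2 * Real.pi : ℂ) * (‖t‖ : ℂ) ^ 2))) ω]
  congr 1; ext t
  simp only [Circle.smul_def, smul_eq_mul, narrowGauss]
  rw [← mul_assoc, ← mul_assoc, ← fourierChar_coe_add, ← fourierChar_coe_add]
  congr 3
  simp only [inner_sub_left, inner_add_right]; ring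

end NarrowGaussian

/-! ### Passing from the narrow to the standard Gaussian window -/

section WindowChange

set_option linter.unusedSectionVars false

variable {V : Type*} [NormedAddCommGroup V] [InnerProductSpace ℝ V] [FiniteDimensional ℝ V]
  [MeasurableSpace V] [BorelSpace V]

lemma integrable_mul_narrowGauss {H : V → ℂ} (hc : Continuous H) {C : ℝ} (hC : ∀ t, ‖H t‖ ≤ C)
    (x : V) : Integrable fun t : V => H t * conj (narrowGauss V (t - x)) := by
  simp_rw [conj_narrowGauss]
  exact (integrable_narrowGauss.comp_sub_right x).bdd_mul hc.aestronglyMeasurable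
    (Filter.Eventually.of_forall hC)

lemma aestronglyMeasurable_stft_narrowGauss {H : V → ℂ} (hc : Continuous H) :
    AEStronglyMeasurable fun z : V × V => stft (narrowGauss V) H z.1 z.2 := by
  unfold stft
  simp only [Real.fourier_eq]
  apply AEStronglyMeasurable.integral_prod_right'
    (f := fun p : (V × V) × V => Real.fourierChar (-⟪p.2, p.1.2⟫) •
      (H p.2 * conj (narrowGauss V (p.2 - p.1.1))))
  apply Continuous.aestronglyMeasurable
  have h1 : Continuous fun p : (V × V) × V => -⟪p.2, p.1.2⟫ :=
    (continuous_snd.inner (continuous_snd.comp continuous_fst)).neg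
  exact (Real.continuous_fourierChar.comp h1).smul ((hc.comp continuous_snd).mul
    (Complex.continuous_conj.comp (continuous_narrowGauss.comp (by fun_prop))))

/-- A bounded continuous function with integrable short-time Fourier transform is integrable. -/
lemma integrable_of_integrable_stft {H : V → ℂ} (hc : Continuous H) {C : ℝ}
    (hC : ∀ t, ‖H t‖ ≤ C)
    (hH : Integrable fun z : V × V => stft (narrowGauss V) H z.1 z.2) : Integrable H := by
  rw [Measure.volume_eq_prod] at hH
  refine Integrable.mono' hH.norm.integral_prod_left hc.aestronglyMeasurable ?_
  filter_upwards [hH.prod_right_ae] with x hx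
  have hcx : Continuous (fun t : V => H t * conj (narrowGauss V (t - x))) :=
    hc.mul (Complex.continuous_conj.comp (continuous_narrowGauss.comp (by fun_prop)))
  -- Inversion is evaluated at `t = x`, where the window equals one, so `|H x|` is at most the
  -- integral of the short-time Fourier transform over frequency.
  have hinv := congrFun (hcx.fourierInv_fourier_eq (integrable_mul_narrowGauss hc hC x) hx) x
  have h0 : conj (narrowGauss V (x - x)) = 1 := by simp [narrowGauss]
  simp only [h0, mul_one] at hinv
  rw [← hinv, Real.fourierInv_eq]
  refine (norm_integral_le_integral_norm _).trans (le_of_eq ?_)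
  simp [Circle.norm_smul, stft]

/-- Translating the window by `w` translates the position variable by `w`. Inserting
`integral_narrowGauss_mul` for the window and exchanging integrals, which needs `H` integrable,
writes one transform as an average of the other. -/
lemma stft_gauss_eq_integral {H : V → ℂ} (hH : Integrable H) (z ζ : V) :
    narrowGaussMass V * stft (gauss V) H z ζ
      = ∫ w : V, stft (narrowGauss V) H (z + w) ζ * narrowGauss V w := by
  unfold stft
  simp only [Real.fourier_eq, ← integral_mul_const]
  rw [integral_integral_swap, ← integral_const_mul]
  · congr 1; ext t
    simp only [Circle.smul_def, smul_eq_mul, conj_gauss, conj_narrowGauss]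
    have h := integral_narrowGauss_mul (t - z)
    calc _ = (Real.fourierChar (-⟪t, ζ⟫) : ℂ) * H t * (narrowGaussMass V * gauss V (t - z)) := by
          ring
      _ = _ := by
          rw [← h, ← integral_const_mul]
          congr 1; ext w
          rw [sub_sub]; ring
  · have h3 : Integrable (fun p : V × V => narrowGauss V p.1 * H p.2) (volume.prod volume) :=
      integrable_narrowGauss.mul_prod hH
    have h4 : Integrable (fun p : V × V =>
        ((Real.fourierChar (-⟪p.2, ζ⟫) : ℂ) * conj (narrowGauss V (p.2 - (z + p.1)))) *
          (narrowGauss V p.1 * H p.2)) (volume.prod volume) := by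
      refine h3.bdd_mul (c := 1) (Continuous.aestronglyMeasurable ?_)
        (Filter.Eventually.of_forall fun p => ?_)
      · have h1 : Continuous fun p : V × V => -⟪p.2, ζ⟫ :=
          (continuous_snd.inner continuous_const).neg
        exact (continuous_subtype_val.comp (Real.continuous_fourierChar.comp h1)).mul
          (Complex.continuous_conj.comp (continuous_narrowGauss.comp (by fun_prop)))
      · rw [norm_mul, Circle.norm_coe, one_mul, conj_narrowGauss]
        exact norm_narrowGauss_le _
    refine h4.congr (Filter.Eventually.of_forall fun p => ?_)
    simp only [Function.uncurry, Circle.smul_def, smul_eq_mul]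
    ring

/-- A bounded continuous function whose short-time Fourier transform with narrow Gaussian window
is integrable belongs to the Feichtinger algebra. -/
lemma memFeichtinger_of_integrable_stft {H : V → ℂ} (hc : Continuous H) {C : ℝ}
    (hC : ∀ t, ‖H t‖ ≤ C)
    (hs : Integrable fun z : V × V => stft (narrowGauss V) H z.1 z.2) : MemFeichtinger H := by
  have hH := integrable_of_integrable_stft hc hC hs
  refine ⟨hc, hH, ?_⟩
  -- This shear turns the integrable product `narrowGauss w · V(z,ζ)` into the integrand of the
  -- averaging formula; integrating out `w` keeps it integrable in `(z,ζ)`.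
  have h1 : MeasurePreserving (fun p : V × (V × V) => (p.1, (p.2.1 + p.1, p.2.2)))
      (volume.prod volume) (volume.prod volume) :=
    (MeasurePreserving.id (volume : Measure V)).skew_product
      (g := fun (w : V) (p : V × V) => (p.1 + w, p.2)) (by fun_prop)
      (Filter.Eventually.of_forall fun w =>
        ((measurePreserving_add_right (volume : Measure V) w).prod
          (MeasurePreserving.id (volume : Measure V))).map_eq)
  have h2 : Integrable (fun p : V × (V × V) =>
      narrowGauss V p.1 * stft (narrowGauss V) H p.2.1 p.2.2) (volume.prod volume) :=
    integrable_narrowGauss.mul_prod hs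
  have h3 := (h1.integrable_comp_of_integrable h2).integral_prod_right
  refine (h3.const_mul (narrowGaussMass V)⁻¹).congr (Filter.Eventually.of_forall fun p => ?_)
  simp only [Function.comp]
  rw [inv_mul_eq_iff_eq_mul₀ narrowGaussMass_ne_zero, stft_gauss_eq_integral hH]
  congr 1; ext w
  rw [mul_comm]

/-- Fourier inversion with integrable `𝓕 f`. This supplies the sup bound on `g` in the Wigner
estimates. -/
lemma MemFeichtinger.exists_norm_le {f : V → ℂ} (hf : MemFeichtinger f) :
    ∃ C, ∀ t, ‖f t‖ ≤ C := by
  refine ⟨∫ w, ‖𝓕 f w‖, fun t => ?_⟩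
  rw [← congrFun (hf.1.fourierInv_fourier_eq hf.2.1 hf.integrable_fourier) t, Real.fourierInv_eq]
  refine (norm_integral_le_integral_norm _).trans (le_of_eq ?_)
  simp [Circle.norm_smul]

end WindowChange

/-! ### The Wigner distribution preserves the Feichtinger algebra -/

section WignerFeichtinger

variable {d : ℕ}

/-- The substitution `t = x + y/2` frees the argument of `f` from `z`. With `g` bounded, `C|f|` then
dominates the integrand uniformly in `z`, giving continuity and boundedness. -/
lemma wigner_eq_integral (f g : Space d → ℂ) (z : Phase d) :
    wigner f g z = (2 : ℂ) ^ d * ∫ t : Space d,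
      (Real.fourierChar (-⟪(2 : ℝ) • (t - z.pos), z.freq⟫) : ℂ) *
        (f t * conj (g ((2 : ℝ) • z.pos - t))) := by
  rw [wigner_eq_fourier, Real.fourier_eq]
  have h := Measure.integral_comp_smul (volume : Measure (Space d))
    (fun y : Space d => Real.fourierChar (-⟪y, z.freq⟫) •
      (f (z.pos + (1 / 2 : ℝ) • y) * conj (g (z.pos - (1 / 2 : ℝ) • y)))) 2
  rw [← integral_sub_right_eq_self _ z.pos] at h
  have h2 : |((2 : ℝ) ^ Module.finrank ℝ (Space d))⁻¹| = ((2 : ℝ) ^ d)⁻¹ := by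
    rw [finrank_euclideanSpace_fin, abs_of_pos (by positivity)]
  rw [h2] at h
  have h3 : ∀ I J : ℂ, J = ((2 : ℝ) ^ d)⁻¹ • I → I = (2 : ℂ) ^ d * J := by
    rintro I J rfl
    rw [Complex.real_smul]
    push_cast
    field_simp
  refine (h3 _ _ h).trans ?_
  congr 2; ext t
  rw [Circle.smul_def, smul_eq_mul]
  congr 4
  · module
  · module

lemma continuous_wigner {f g : Space d → ℂ} (hf : Continuous f) (hg : Continuous g)
    (hfi : Integrable f) {C : ℝ} (hC : ∀ t, ‖g t‖ ≤ C) : Continuous (wigner f g) := by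
  have e : wigner f g = fun z => _ := funext fun z => wigner_eq_integral f g z
  rw [e]
  refine continuous_const.mul (continuous_of_dominated (bound := fun t => ‖f t‖ * C)
    (fun z => ?_) (fun z => ?_) (hfi.norm.mul_const C) ?_)
  · apply Continuous.aestronglyMeasurable
    have h1 : Continuous fun t : Space d => -⟪(2 : ℝ) • (t - z.pos), z.freq⟫ := by fun_prop
    exact (continuous_subtype_val.comp (Real.continuous_fourierChar.comp h1)).mul
      (hf.mul (Complex.continuous_conj.comp (hg.comp (by fun_prop))))
  · refine Filter.Eventually.of_forall fun t => ?_
    rw [norm_mul, Circle.norm_coe, one_mul, norm_mul, RCLike.norm_conj]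
    exact mul_le_mul_of_nonneg_left (hC _) (norm_nonneg _)
  · refine Filter.Eventually.of_forall fun t => ?_
    have hp := Phase.continuous_pos (d := d)
    have hq := Phase.continuous_freq (d := d)
    have h1 : Continuous fun z : Phase d => -⟪(2 : ℝ) • (t - z.pos), z.freq⟫ := by fun_prop
    exact (continuous_subtype_val.comp (Real.continuous_fourierChar.comp h1)).mul
      (continuous_const.mul (Complex.continuous_conj.comp (hg.comp (by fun_prop))))

lemma norm_wigner_le {f g : Space d → ℂ} (hfi : Integrable f) {C : ℝ} (hC : ∀ t, ‖g t‖ ≤ C)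
    (z : Phase d) : ‖wigner f g z‖ ≤ 2 ^ d * ((∫ t, ‖f t‖) * C) := by
  rw [wigner_eq_integral, norm_mul, norm_pow, Complex.norm_ofNat]
  refine mul_le_mul_of_nonneg_left ?_ (by positivity)
  rw [← integral_mul_const]
  refine (norm_integral_le_integral_norm _).trans (integral_mono_of_nonneg
    (Filter.Eventually.of_forall fun t => norm_nonneg _) (hfi.norm.mul_const C)
    (Filter.Eventually.of_forall fun t => ?_))
  dsimp only
  rw [norm_mul, Circle.norm_coe, one_mul, norm_mul, RCLike.norm_conj]
  exact mul_le_mul_of_nonneg_left (hC _) (norm_nonneg _)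

lemma narrowGauss_mk (x ω : Space d) :
    narrowGauss (Phase d) (Phase.mk x ω) = narrowGauss (Space d) x * narrowGauss (Space d) ω := by
  unfold narrowGauss
  rw [← Complex.exp_add]
  congr 1
  have h := congrArg (fun r : ℝ => (r : ℂ)) (Phase.norm_sq_eq (Phase.mk x ω))
  push_cast at h
  rw [h]; simp only [Phase.pos_mk, Phase.freq_mk]; ring

/-- The short-time Fourier transform of `W(f, g)` splits into the short-time Fourier transforms
of `f` and `g`. -/
lemma exists_norm_stft_wigner : ∃ κ : ℝ, ∀ {f g : Space d → ℂ}, Continuous f → Continuous g →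
    Integrable f → Integrable g → (∃ C, ∀ t, ‖g t‖ ≤ C) → ∀ z ζ : Phase d,
    ‖stft (narrowGauss (Phase d)) (wigner f g) z ζ‖
      = κ * (‖stft (gauss (Space d)) f (z.pos - (1 / 2 : ℝ) • ζ.freq)
            (z.freq + (1 / 2 : ℝ) • ζ.pos)‖ *
          ‖stft (gauss (Space d)) g (z.pos + (1 / 2 : ℝ) • ζ.freq)
            (z.freq - (1 / 2 : ℝ) • ζ.pos)‖) := by
  obtain ⟨κ, hκ⟩ := exists_fourier_narrowGauss_shift (V := Space d)
  refine ⟨‖κ‖, fun {f g} hf hg hfi hgi ⟨C, hC⟩ z ζ => ?_⟩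
  set x := z.pos with hx
  set ω := z.freq with hω
  set ξ := ζ.pos with hξ
  set η := ζ.freq with hη
  set a := x - (1 / 2 : ℝ) • η with ha
  set b := x + (1 / 2 : ℝ) • η with hb
  have hcont := continuous_wigner hf hg hfi hC
  set P : Space d → ℂ := fun u =>
    Real.fourierChar (-⟪u, ω + (1 / 2 : ℝ) • ξ⟫) • (f u * conj (gauss (Space d) (u - a))) with hP
  set Q : Space d → ℂ := fun v =>
    Real.fourierChar (-⟪v, ω - (1 / 2 : ℝ) • ξ⟫) • (g v * conj (gauss (Space d) (v - b))) with hQ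
  have hPi : Integrable P := (Real.fourierIntegral_convergent_iff _).2 (integrable_mul_gauss hfi a)
  have hQi : Integrable Q := (Real.fourierIntegral_convergent_iff _).2 (integrable_mul_gauss hgi b)
  have hQi' : Integrable fun v => conj (Q v) := Complex.conjCLE.integrable_comp_iff.2 hQi
  -- In the variables `u = x' + y/2`, `v = x' - y/2` the integrand separates. For the Gaussians this
  -- is the parallelogram law `2|p|² + |q|²/2 = |p + q/2|² + |p - q/2|²` with `p = x' - x`, `q = η +
  -- y`; for the characters it is bilinearity.
  have hsplit : ∀ x' y : Space d,
      (Real.fourierChar (-⟪x', ξ⟫) : ℂ) * narrowGauss (Space d) (x' - x) *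
        (wignerPair f g x' y * ((Real.fourierChar (-⟪ω, η + y⟫) : ℂ) *
          Complex.exp (-(Real.pi / 2 : ℂ) * (‖η + y‖ : ℂ) ^ 2)))
      = (Real.fourierChar (-⟪ω, η⟫) : ℂ) *
        (P (x' + (1 / 2 : ℝ) • y) * conj (Q (x' - (1 / 2 : ℝ) • y))) := by
    intro x' y
    have hG : narrowGauss (Space d) (x' - x) *
        Complex.exp (-(Real.pi / 2 : ℂ) * (‖η + y‖ : ℂ) ^ 2)
        = gauss (Space d) (x' + (1 / 2 : ℝ) • y - a) *
          gauss (Space d) (x' - (1 / 2 : ℝ) • y - b) := by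
      unfold narrowGauss gauss
      rw [← Complex.exp_add, ← Complex.exp_add]
      congr 1
      have h : 2 * ‖x' - x‖ ^ 2 + (1 / 2) * ‖η + y‖ ^ 2
          = ‖x' + (1 / 2 : ℝ) • y - a‖ ^ 2 + ‖x' - (1 / 2 : ℝ) • y - b‖ ^ 2 := by
        have e1 : x' + (1 / 2 : ℝ) • y - a = (x' - x) + (1 / 2 : ℝ) • (η + y) := by
          rw [ha]; module
        have e2 : x' - (1 / 2 : ℝ) • y - b = (x' - x) - (1 / 2 : ℝ) • (η + y) := by
          rw [hb]; module
        rw [e1, e2, norm_add_sq_real (x' - x), norm_sub_sq_real (x' - x), norm_smul]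
        norm_num
        ring
      have h' := congrArg (fun r : ℝ => (r : ℂ)) h
      push_cast at h'
      linear_combination (-(Real.pi : ℂ)) * h'
    have hE : (Real.fourierChar (-⟪x', ξ⟫) : ℂ) * Real.fourierChar (-⟪ω, η + y⟫)
        = Real.fourierChar (-⟪ω, η⟫) *
          (Real.fourierChar (-⟪x' + (1 / 2 : ℝ) • y, ω + (1 / 2 : ℝ) • ξ⟫) *
            conj (Real.fourierChar (-⟪x' - (1 / 2 : ℝ) • y, ω - (1 / 2 : ℝ) • ξ⟫) : ℂ)) := by
      rw [← Circle.coe_inv_eq_conj, ← AddChar.map_neg_eq_inv, ← fourierChar_coe_add,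
        ← fourierChar_coe_add, ← fourierChar_coe_add]
      congr 2
      simp only [inner_add_left, inner_add_right, inner_sub_left, inner_sub_right,
        real_inner_smul_right, real_inner_comm]
      rw [real_inner_comm ω y, real_inner_comm ω x']
      ring
    simp only [hP, hQ, Circle.smul_def, smul_eq_mul, map_mul, conj_gauss, wignerPair]
    linear_combination (f (x' + (1 / 2 : ℝ) • y) * conj (g (x' - (1 / 2 : ℝ) • y))) *
      ((Real.fourierChar (-⟪x', ξ⟫) : ℂ) * Real.fourierChar (-⟪ω, η + y⟫) * hG +
        gauss (Space d) (x' + (1 / 2 : ℝ) • y - a) *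
          gauss (Space d) (x' - (1 / 2 : ℝ) • y - b) * hE)
  have key : stft (narrowGauss (Phase d)) (wigner f g) z ζ
      = κ * ((Real.fourierChar (-⟪ω, η⟫) : ℂ) *
        (stft (gauss (Space d)) f a (ω + (1 / 2 : ℝ) • ξ) *
          conj (stft (gauss (Space d)) g b (ω - (1 / 2 : ℝ) • ξ)))) := by
    have hWi := (Real.fourierIntegral_convergent_iff ζ).2
      (integrable_mul_narrowGauss hcont (norm_wigner_le hfi hC) z)
    unfold stft
    rw [Real.fourier_eq, Phase.integral_eq]
    have hWi' := (Phase.integrable_iff _).1 hWi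
    rw [Measure.volume_eq_prod] at hWi' ⊢
    rw [integral_prod _ hWi']
    have hinner : ∀ x' : Space d, ∫ ω' : Space d, Real.fourierChar (-⟪Phase.mk x' ω', ζ⟫) •
          (wigner f g (Phase.mk x' ω') *
            conj (narrowGauss (Phase d) (Phase.mk x' ω' - z)))
        = κ * ((Real.fourierChar (-⟪ω, η⟫) : ℂ) *
          ∫ y : Space d, P (x' + (1 / 2 : ℝ) • y) * conj (Q (x' - (1 / 2 : ℝ) • y))) := by
      intro x'
      have hH : Integrable fun t : Space d =>
          (Real.fourierChar (-⟪t, η⟫) : ℂ) * narrowGauss (Space d) (t - ω) := by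
        have := (Real.fourierIntegral_convergent_iff η).2
          ((integrable_narrowGauss (V := Space d)).comp_sub_right ω)
        simpa only [Circle.smul_def, smul_eq_mul] using this
      -- Parseval in the frequency variable moves the Fourier transform from `wignerPair f g x'` to
      -- the shifted Gaussian, where it is explicit.
      have hpars := VectorFourier.integral_fourierIntegral_smul_eq_flip (L := innerₗ (Space d))
        Real.continuous_fourierChar continuous_inner
        (integrable_wignerPair_right hfi hg hC x') hH
      have hpars' : ∫ t, 𝓕 (wignerPair f g x') t *
            ((Real.fourierChar (-⟪t, η⟫) : ℂ) * narrowGauss (Space d) (t - ω))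
          = ∫ y, wignerPair f g x' y * 𝓕 (fun t : Space d =>
            (Real.fourierChar (-⟪t, η⟫) : ℂ) * narrowGauss (Space d) (t - ω)) y := by
        simpa using! hpars
      rw [← integral_const_mul, ← integral_const_mul]
      calc _ = (Real.fourierChar (-⟪x', ξ⟫) : ℂ) * narrowGauss (Space d) (x' - x) *
            ∫ t, 𝓕 (wignerPair f g x') t *
              ((Real.fourierChar (-⟪t, η⟫) : ℂ) * narrowGauss (Space d) (t - ω)) := by
            rw [← integral_const_mul]
            congr 1; ext t
            have e1 : Phase.mk x' t - z = Phase.mk (x' - x) (t - ω) := Phase.ext' rfl rfl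
            rw [conj_narrowGauss, e1, narrowGauss_mk, wigner_eq_fourier, Phase.inner_eq, neg_add,
              Circle.smul_def, smul_eq_mul, fourierChar_coe_add]
            simp only [Phase.pos_mk, Phase.freq_mk]
            change _ * (𝓕 (wignerPair f g x') t * _) = _
            ring
        _ = _ := by
            rw [hpars', ← integral_const_mul]
            congr 1; ext y
            rw [hκ, ← hsplit x' y]
            ring
    simp only [hinner]
    rw [integral_const_mul, integral_const_mul]
    congr 2
    have hmp := measurePreserving_wignerPair (V := Space d)
    have hPQ : Integrable (fun p : Space d × Space d => P p.1 * conj (Q p.2)) volume :=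
      hPi.mul_prod hQi'
    have hPQ' : Integrable (fun p : Space d × Space d => P (p.1 + (1 / 2 : ℝ) • p.2) *
        conj (Q (p.1 - (1 / 2 : ℝ) • p.2))) := hmp.integrable_comp_of_integrable hPQ
    have e2 : ∫ p : Space d × Space d, P (p.1 + (1 / 2 : ℝ) • p.2) *
          conj (Q (p.1 - (1 / 2 : ℝ) • p.2))
        = ∫ p : Space d × Space d, P p.1 * conj (Q p.2) := by
      conv_rhs => rw [← hmp.map_eq]
      rw [integral_map hmp.aemeasurable]
      rw [hmp.map_eq]; exact hPQ.aestronglyMeasurable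
    have e3 : ∫ p : Space d × Space d, P p.1 * conj (Q p.2) ∂(volume.prod volume)
        = (∫ u, P u) * conj (∫ v, Q v) := by
      rw [integral_prod_mul P fun v => conj (Q v), integral_conj]
    rw [Measure.volume_eq_prod] at e2 hPQ'
    rw [integral_prod _ hPQ', e3] at e2
    exact e2
  rw [key, norm_mul, norm_mul, norm_mul, Circle.norm_coe, one_mul, RCLike.norm_conj]

lemma measurePreserving_equivProd :
    MeasurePreserving (fun z : Phase d => (z.pos, z.freq)) volume volume :=
  MeasurePreserving.symm (Phase.equivProd (d := d)).symm.toHomeomorph.toMeasurableEquiv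
    Phase.measurePreserving_mk

/-- `W(f, g) ∈ S₀(ℝ^{2d})` for `f, g ∈ S₀(ℝ^d)`. -/
lemma MemFeichtinger.wigner {f g : Space d → ℂ} (hf : MemFeichtinger f) (hg : MemFeichtinger g) :
    MemFeichtinger (wigner f g) := by
  obtain ⟨C, hC⟩ := hg.exists_norm_le
  have hcont := continuous_wigner hf.1 hg.1 hf.2.1 hC
  refine memFeichtinger_of_integrable_stft hcont (norm_wigner_le hf.2.1 hC) ?_
  rw [← integrable_norm_iff (aestronglyMeasurable_stft_narrowGauss hcont)]
  obtain ⟨κ, hκ⟩ := exists_norm_stft_wigner (d := d)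
  simp only [hκ hf.1 hg.1 hf.2.1 hg.2.1 ⟨C, hC⟩]
  refine Integrable.const_mul ?_ κ
  have h1 : Integrable fun z : Phase d => ‖stft (gauss (Space d)) f z.pos z.freq‖ :=
    measurePreserving_equivProd.integrable_comp_of_integrable hf.2.2.norm
  have h2 : Integrable fun z : Phase d => ‖stft (gauss (Space d)) g z.pos z.freq‖ :=
    measurePreserving_equivProd.integrable_comp_of_integrable hg.2.2.norm
  have h3 : Integrable (fun p : Phase d × Phase d => ‖stft (gauss (Space d)) f p.1.pos p.1.freq‖ *
      ‖stft (gauss (Space d)) g p.2.pos p.2.freq‖) (volume.prod volume) := h1.mul_prod h2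
  -- With `Jζ = (-η, ξ)` the two arguments in the splitting formula are `z + Jζ/2` and `z - Jζ/2`,
  -- so the change of variables of `measurePreserving_wignerPair` applies on phase space.
  have hJ : MeasurePreserving (fun z : Phase d => Phase.mk (-z.freq) z.pos) volume volume :=
    Phase.measurePreserving_mk.comp
      ((measurePreserving_neg_swap (V := Space d)).comp measurePreserving_equivProd)
  have hmp := measurePreserving_wignerPair.comp ((MeasurePreserving.id volume).prod hJ)
  refine (hmp.integrable_comp_of_integrable h3).congr (Filter.Eventually.of_forall fun p => ?_)
  simp only [Function.comp, Prod.map, id, Phase.pos_add, Phase.freq_add, Phase.pos_sub,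
    Phase.freq_sub, Phase.pos_smul, Phase.freq_smul, Phase.pos_mk, Phase.freq_mk, smul_neg,
    sub_neg_eq_add, ← sub_eq_add_neg]

end WignerFeichtinger

/-! ### Tensor products of Schwartz functions and growth of characters -/

section SchwartzTensor

variable {E E₁ E₂ : Type*} [NormedAddCommGroup E] [NormedSpace ℝ E] [NormedAddCommGroup E₁]
  [NormedSpace ℝ E₁] [NormedAddCommGroup E₂] [NormedSpace ℝ E₂]

lemma SchwartzMap.exists_one_add_pow_mul_le (f : 𝓢(E, ℂ)) (k n : ℕ) :
    ∃ C, 0 ≤ C ∧ ∀ i ≤ n, ∀ x, (1 + ‖x‖) ^ k * ‖iteratedFDeriv ℝ i f x‖ ≤ C :=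
  ⟨_, by positivity, fun _ hi x =>
    SchwartzMap.one_add_le_sup_seminorm_apply (𝕜 := ℝ) (m := (k, n)) le_rfl hi f x⟩

/-- The tensor product `z ↦ f(L₁ z) g(L₂ z)` of two Schwartz functions, where `(L₁, L₂)` are
complementary coordinates. -/
def schwartzTensor (L₁ : E →L[ℝ] E₁) (L₂ : E →L[ℝ] E₂) (hL : ∀ z, ‖z‖ ≤ ‖L₁ z‖ + ‖L₂ z‖)
    (f : 𝓢(E₁, ℂ)) (g : 𝓢(E₂, ℂ)) : 𝓢(E, ℂ) where
  toFun z := f (L₁ z) * g (L₂ z)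
  smooth' := ((f.smooth ⊤).comp L₁.contDiff).mul ((g.smooth ⊤).comp L₂.contDiff)
  decay' k n := by
    obtain ⟨C, hC0, hC⟩ := SchwartzMap.exists_one_add_pow_mul_le f k n
    obtain ⟨D, hD0, hD⟩ := SchwartzMap.exists_one_add_pow_mul_le g k n
    refine ⟨∑ i ∈ Finset.range (n + 1),
      (n.choose i : ℝ) * ((C * ‖L₁‖ ^ i) * (D * ‖L₂‖ ^ (n - i))), fun z => ?_⟩
    have h1 := norm_iteratedFDeriv_mul_le (n := n) ((f.smooth ⊤).comp L₁.contDiff)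
      ((g.smooth ⊤).comp L₂.contDiff) z (by exact_mod_cast le_top)
    -- The hypothesis `hL` lets the weight be shared: in each Leibniz term each factor absorbs its
    -- own power.
    have hz : ‖z‖ ^ k ≤ (1 + ‖L₁ z‖) ^ k * (1 + ‖L₂ z‖) ^ k := by
      rw [← mul_pow]
      refine pow_le_pow_left₀ (norm_nonneg _) ((hL z).trans ?_) k
      nlinarith [norm_nonneg (L₁ z), norm_nonneg (L₂ z)]
    refine (mul_le_mul hz h1 (norm_nonneg _) (by positivity)).trans ?_
    rw [Finset.mul_sum]
    refine Finset.sum_le_sum fun i hi => ?_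
    have hi' : i ≤ n := Nat.lt_succ_iff.1 (Finset.mem_range.1 hi)
    have b1 : ‖iteratedFDeriv ℝ i (f ∘ L₁) z‖ ≤ ‖iteratedFDeriv ℝ i f (L₁ z)‖ * ‖L₁‖ ^ i := by
      rw [L₁.iteratedFDeriv_comp_right (f.smooth ⊤) z (by exact_mod_cast le_top)]
      simpa using ContinuousMultilinearMap.norm_compContinuousLinearMap_le
        (iteratedFDeriv ℝ i f (L₁ z)) fun _ => L₁
    have b2 : ‖iteratedFDeriv ℝ (n - i) (g ∘ L₂) z‖
        ≤ ‖iteratedFDeriv ℝ (n - i) g (L₂ z)‖ * ‖L₂‖ ^ (n - i) := by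
      rw [L₂.iteratedFDeriv_comp_right (g.smooth ⊤) z
        (by generalize n - i = j; exact_mod_cast le_top)]
      simpa using ContinuousMultilinearMap.norm_compContinuousLinearMap_le
        (iteratedFDeriv ℝ (n - i) g (L₂ z)) fun _ => L₂
    have c1 : (1 + ‖L₁ z‖) ^ k * ‖iteratedFDeriv ℝ i (f ∘ L₁) z‖ ≤ C * ‖L₁‖ ^ i := by
      refine (mul_le_mul_of_nonneg_left b1 (by positivity)).trans ?_
      rw [← mul_assoc]
      exact mul_le_mul_of_nonneg_right (hC i hi' _) (by positivity)
    have c2 : (1 + ‖L₂ z‖) ^ k * ‖iteratedFDeriv ℝ (n - i) (g ∘ L₂) z‖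
        ≤ D * ‖L₂‖ ^ (n - i) := by
      refine (mul_le_mul_of_nonneg_left b2 (by positivity)).trans ?_
      rw [← mul_assoc]
      exact mul_le_mul_of_nonneg_right (hD _ (Nat.sub_le _ _) _) (by positivity)
    calc _ = (n.choose i : ℝ) * (((1 + ‖L₁ z‖) ^ k * ‖iteratedFDeriv ℝ i (f ∘ L₁) z‖) *
          ((1 + ‖L₂ z‖) ^ k * ‖iteratedFDeriv ℝ (n - i) (g ∘ L₂) z‖)) := by ring
      _ ≤ _ := by
        refine mul_le_mul_of_nonneg_left (mul_le_mul c1 c2 (by positivity) (by positivity))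
          (by positivity)

lemma schwartzTensor_apply (L₁ : E →L[ℝ] E₁) (L₂ : E →L[ℝ] E₂)
    (hL : ∀ z, ‖z‖ ≤ ‖L₁ z‖ + ‖L₂ z‖) (f : 𝓢(E₁, ℂ)) (g : 𝓢(E₂, ℂ)) (z : E) :
    schwartzTensor L₁ L₂ hL f g z = f (L₁ z) * g (L₂ z) := rfl

/-- Each derivative is a constant multiple of the character, so it is bounded and the growth
exponent can be 0. Composition with a form of temperate growth then makes chirps admissible
multipliers on Schwartz functions. -/
lemma hasTemperateGrowth_fourierChar :
    Function.HasTemperateGrowth fun t : ℝ => (Real.fourierChar t : ℂ) := by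
  have e : (fun t : ℝ => (Real.fourierChar t : ℂ))
      = fun t : ℝ => Complex.exp ((2 * Real.pi * Complex.I) * t) := by
    ext t
    rw [Real.fourierChar_apply]
    congr 1; push_cast; ring
  rw [e]
  refine ⟨(contDiff_const.mul Complex.ofRealCLM.contDiff).cexp,
    fun n => ⟨0, (2 * Real.pi) ^ n, fun t => ?_⟩⟩
  rw [norm_iteratedFDeriv_eq_norm_iteratedDeriv]
  have h : ∀ n : ℕ, iteratedDeriv n (fun t : ℝ => Complex.exp ((2 * Real.pi * Complex.I) * t))
      = fun t : ℝ => (2 * Real.pi * Complex.I) ^ n *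
        Complex.exp ((2 * Real.pi * Complex.I) * t) := by
    intro n
    induction n with
    | zero => simp
    | succ n ih =>
      rw [iteratedDeriv_succ, ih]
      ext t
      have h1 : HasDerivAt (fun t : ℝ => (2 * Real.pi * Complex.I) * (t : ℂ))
          (2 * Real.pi * Complex.I) t := by
        simpa using (Complex.ofRealCLM.hasDerivAt (x := t)).const_mul (2 * Real.pi * Complex.I)
      rw [((h1.cexp).const_mul _).deriv]
      ring
  rw [h]
  simp [Complex.norm_exp, abs_of_pos Real.pi_pos]

end SchwartzTensor

/-! ### The Wigner distribution of Schwartz functions is Schwartz -/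

section WignerSchwartz

variable {d : ℕ}

/-- The exchange `(x, ω) ↦ (2ω, 2x)` of position and frequency. -/
def Phase.doubleSwap : Phase d ≃L[ℝ] Phase d :=
  LinearEquiv.toContinuousLinearEquiv
    { toFun := fun z => Phase.mk ((2 : ℝ) • z.freq) ((2 : ℝ) • z.pos)
      map_add' := fun z w => Phase.ext' (by simp) (by simp)
      map_smul' := fun c z => Phase.ext' (by simp [smul_comm c]) (by simp [smul_comm c])
      invFun := fun z => Phase.mk ((1 / 2 : ℝ) • z.freq) ((1 / 2 : ℝ) • z.pos)
      left_inv := fun z => Phase.ext' (by simp [smul_smul]) (by simp [smul_smul])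
      right_inv := fun z => Phase.ext' (by simp [smul_smul]) (by simp [smul_smul]) }

lemma Phase.doubleSwap_apply (z : Phase d) :
    Phase.doubleSwap z = Phase.mk ((2 : ℝ) • z.freq) ((2 : ℝ) • z.pos) := rfl

/-- The coordinate `z ↦ x` as a continuous linear map. -/
def Phase.posL : Phase d →L[ℝ] Space d :=
  (ContinuousLinearMap.fst ℝ _ _).comp (Phase.equivProd (d := d)).toContinuousLinearMap

/-- The coordinate `z ↦ ω` as a continuous linear map. -/
def Phase.freqL : Phase d →L[ℝ] Space d :=
  (ContinuousLinearMap.snd ℝ _ _).comp (Phase.equivProd (d := d)).toContinuousLinearMap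

lemma Phase.norm_le (z : Phase d) : ‖z‖ ≤ ‖Phase.posL z‖ + ‖Phase.freqL z‖ := by
  have h : ‖z‖ ^ 2 = ‖Phase.posL z‖ ^ 2 + ‖Phase.freqL z‖ ^ 2 := Phase.norm_sq_eq z
  refine abs_le_of_sq_le_sq' ?_ (by positivity) |>.2
  nlinarith [norm_nonneg (Phase.posL z), norm_nonneg (Phase.freqL z)]

lemma hasTemperateGrowth_phase_inner (c : ℝ) :
    Function.HasTemperateGrowth fun z : Phase d => c * ⟪z.pos, z.freq⟫ := by
  have h := (innerSL ℝ (E := Space d)).bilinear_hasTemperateGrowth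
    (Phase.posL (d := d)).hasTemperateGrowth (Phase.freqL (d := d)).hasTemperateGrowth
  exact (Function.HasTemperateGrowth.const c).mul h

/-- For Schwartz functions `f, g` the function `W(f, g)` is a Schwartz function. -/
lemma exists_schwartz_eq_wigner (f g : 𝓢(Space d, ℂ)) :
    ∃ F : 𝓢(Phase d, ℂ), ∀ z, F z = wigner f g z := by
  -- With `G(r) = conj g(-r)`, the factor `conj g(2x - t) = G(t - 2x)` is expanded by Fourier
  -- inversion. This gives `W(x,ω) = 2^d e^{4πi x·ω} 𝓕P(2ω,2x)` with `P(t,s) = e^{2πi t·s} f(t)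
  -- 𝓕G(s)`, and every operation involved preserves Schwartz functions.
  set G : 𝓢(Space d, ℂ) := compCLMOfContinuousLinearEquiv ℝ
    (ContinuousLinearEquiv.neg ℝ (M := Space d))
    (SchwartzMap.postcompCLM (𝕜 := ℝ) (Complex.conjCLE : ℂ →L[ℝ] ℂ) g) with hG
  have hGa : ∀ r, G r = conj (g (-r)) := fun r => by simp [hG]
  set P : 𝓢(Phase d, ℂ) := SchwartzMap.smulLeftCLM ℂ
    (fun z : Phase d => (Real.fourierChar (1 * ⟪z.pos, z.freq⟫) : ℂ))
    (schwartzTensor Phase.posL Phase.freqL Phase.norm_le f (𝓕 G)) with hP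
  have hchar : ∀ c : ℝ, Function.HasTemperateGrowth
      fun z : Phase d => (Real.fourierChar (c * ⟪z.pos, z.freq⟫) : ℂ) := fun c =>
    hasTemperateGrowth_fourierChar.comp (hasTemperateGrowth_phase_inner c)
  have hPa : ∀ t s : Space d, P (Phase.mk t s)
      = (Real.fourierChar ⟪t, s⟫ : ℂ) * (f t * 𝓕 (G : Space d → ℂ) s) := fun t s => by
    rw [hP, SchwartzMap.smulLeftCLM_apply_apply (hchar 1), smul_eq_mul, one_mul]
    rfl
  refine ⟨(2 : ℂ) ^ d • SchwartzMap.smulLeftCLM ℂ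
    (fun z : Phase d => (Real.fourierChar (2 * ⟪z.pos, z.freq⟫) : ℂ))
    (compCLMOfContinuousLinearEquiv ℂ Phase.doubleSwap (𝓕 P)), fun z => ?_⟩
  rw [smul_apply, SchwartzMap.smulLeftCLM_apply_apply (hchar 2), smul_eq_mul,
    smul_eq_mul, wigner_eq_integral]
  congr 1
  rw [compCLMOfContinuousLinearEquiv_apply]
  change _ * 𝓕 (P : Phase d → ℂ) (Phase.doubleSwap z) = _
  rw [Real.fourier_eq, Phase.integral_eq]
  have hPi := (Phase.integrable_iff _).1
    ((Real.fourierIntegral_convergent_iff (Phase.doubleSwap z)).2 P.integrable)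
  rw [Measure.volume_eq_prod] at hPi ⊢
  rw [integral_prod _ hPi, ← integral_const_mul]
  congr 1; ext t
  have hinv : conj (g ((2 : ℝ) • z.pos - t)) = 𝓕⁻ (𝓕 (G : Space d → ℂ)) (t - (2 : ℝ) • z.pos) := by
    rw [G.continuous.fourierInv_fourier_eq G.integrable (𝓕 G).integrable, hGa, neg_sub]
  rw [hinv, Real.fourierInv_eq, ← integral_const_mul, ← integral_const_mul, ← integral_const_mul]
  congr 1; ext s
  simp only [hPa, Circle.smul_def, smul_eq_mul]
  have he : (Real.fourierChar (2 * ⟪z.pos, z.freq⟫) : ℂ) *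
      (Real.fourierChar (-⟪Phase.mk t s, Phase.doubleSwap z⟫) * Real.fourierChar ⟪t, s⟫)
      = Real.fourierChar (-⟪(2 : ℝ) • (t - z.pos), z.freq⟫) *
        Real.fourierChar ⟪s, t - (2 : ℝ) • z.pos⟫ := by
    simp only [← fourierChar_coe_add]
    congr 2
    simp only [Phase.inner_eq, Phase.doubleSwap_apply, Phase.pos_mk, Phase.freq_mk,
      inner_sub_left, inner_sub_right, real_inner_smul_left, real_inner_smul_right]
    rw [real_inner_comm t s]
    ring
  linear_combination (f t * 𝓕 (G : Space d → ℂ) s) * he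

end WignerSchwartz

/-! ### The kernel `𝓕Θ_M` on Schwartz functions and on `S₀` -/

section CohenKernel

variable {d : ℕ}

lemma temperedOfFun_apply {V : Type*} [NormedAddCommGroup V] [InnerProductSpace ℝ V]
    [FiniteDimensional ℝ V] [MeasurableSpace V] [BorelSpace V] (h : V →ᵇ ℂ) (φ : 𝓢(V, ℂ)) :
    temperedOfFun h φ = ∫ v, h v * φ v := by
  unfold temperedOfFun
  rw [Lp.toTemperedDistribution_apply]
  refine integral_congr_ae ?_
  filter_upwards [(memLp_top_of_bound h.continuous.aestronglyMeasurable ‖h‖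
      (Filter.Eventually.of_forall h.norm_coe_le_norm)).coeFn_toLp] with v hv
  rw [hv, smul_eq_mul, mul_comm]

/-- As a tempered distribution, `𝓕 Θ_M` is a Cohen kernel of `W_M`. -/
lemma isCohenKernel_cohenMatrix (M : Matrix (Fin d) (Fin d) ℝ) :
    IsCohenKernel (matrixWigner (cohenMatrix M)) (𝓕 (temperedOfFun (chirp M))) := by
  intro f g
  obtain ⟨F, hF⟩ := exists_schwartz_eq_wigner f g
  have hFW : (F : Phase d → ℂ) = wigner f g := funext hF
  refine ⟨F, hF, fun z => ?_⟩
  rw [matrixWigner_cohenMatrix_eq_integral f.continuous g.continuous f.integrable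
    g.toBoundedContinuousFunction.norm_coe_le_norm
    (hFW ▸ F.integrable) (hFW ▸ (𝓕 F).integrable) M z]
  unfold convTempered
  rw [TemperedDistribution.fourier_apply, temperedOfFun_apply]
  congr 1; ext ζ
  rw [SchwartzMap.fourier_coe]
  refine congrArg (fun H : Phase d → ℂ => chirp M ζ * 𝓕 H ζ) (funext fun w => ?_)
  rw [convTempered_arg, hF]

/-- On `S₀` the distribution `W_M(f, g)` is the convolution of `W(f, g)` with `θ_M`. -/
lemma exists_convFeichtinger_eq (M : Matrix (Fin d) (Fin d) ℝ) (f g : Feichtinger (Space d)) :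
    ∃ F : Feichtinger (Phase d), (∀ z : Phase d, (F : Phase d → ℂ) z = wigner f g z) ∧
      ∀ z : Phase d,
        matrixWigner (cohenMatrix M) f g z = convFeichtinger F (cohenKernel M) z := by
  have hf : MemFeichtinger (f : Space d → ℂ) := f.2
  have hg : MemFeichtinger (g : Space d → ℂ) := g.2
  have hW := hf.wigner hg
  obtain ⟨C, hC⟩ := hg.exists_norm_le
  -- Unfolding the duality definitions, the convolution with `cohenKernel M` is literally the
  -- multiplier integral.
  exact ⟨⟨_, hW⟩, fun _ => rfl, fun z =>
    matrixWigner_cohenMatrix_eq_integral hf.1 hg.1 hf.2.1 hC hW.2.1 hW.integrable_fourier M z⟩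

end CohenKernel

/-! ### The explicit kernel for invertible `M`, by Gaussian regularisation -/

section ExplicitKernel

variable {d : ℕ}

/-- This form matches the value at `c = 0` of the integrand in `fourier_chirp_mul_gauss`. -/
lemma explicitKernel_apply (M : Matrix (Fin d) (Fin d) ℝ) (z : Phase d) :
    explicitKernel M z = ((|M.det|⁻¹ : ℝ) : ℂ) *
      Real.fourierChar (-⟪M⁻¹.toEuclideanLin (-z.pos), z.freq⟫) := by
  rw [Real.fourierChar_apply]
  change _ * Complex.exp _ = _
  congr 2
  rw [map_neg, inner_neg_left, real_inner_comm]
  push_cast; ring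

lemma gauss_mk (x ω : Space d) :
    gauss (Phase d) (Phase.mk x ω) = gauss (Space d) x * gauss (Space d) ω := by
  unfold gauss
  rw [← Complex.exp_add]
  congr 1
  have h := congrArg (fun r : ℝ => (r : ℂ)) (Phase.norm_sq_eq (Phase.mk x ω))
  push_cast at h
  rw [h]; simp only [Phase.pos_mk, Phase.freq_mk]; ring

lemma integrable_chirp_mul_gauss (M : Matrix (Fin d) (Fin d) ℝ) {c : ℝ} (hc : c ≠ 0) :
    Integrable fun ζ : Phase d => chirp M ζ * gauss (Phase d) (c • ζ) :=
  (integrable_gauss.comp_smul hc).bdd_mul (chirp M).continuous.aestronglyMeasurable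
    (Filter.Eventually.of_forall (chirp M).norm_coe_le_norm)

lemma integral_fourierChar_mul_gauss_smul {c : ℝ} (hc : 0 < c) (v : Space d) :
    ∫ ξ : Space d, (Real.fourierChar (-⟪ξ, v⟫) : ℂ) * gauss (Space d) (c • ξ)
      = (((c ^ d)⁻¹ : ℝ) : ℂ) * gauss (Space d) (c⁻¹ • v) := by
  have h := Measure.integral_comp_smul (volume : Measure (Space d))
    (fun t : Space d => Real.fourierChar (-⟪t, c⁻¹ • v⟫) • gauss (Space d) t) c
  rw [← Real.fourier_eq, fourier_gauss, finrank_euclideanSpace_fin, abs_of_pos (by positivity),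
    Complex.real_smul] at h
  rw [← h]
  congr 1; ext ξ
  rw [Circle.smul_def, smul_eq_mul, real_inner_smul_left, real_inner_smul_right,
    mul_inv_cancel_left₀ hc.ne']

lemma integral_comp_toEuclideanLin {M : Matrix (Fin d) (Fin d) ℝ} (hM : IsUnit M.det)
    {h : Space d → ℂ} (hh : Continuous h) :
    ∫ η, h η = ((|M.det|⁻¹ : ℝ) : ℂ) * ∫ v, h (M⁻¹.toEuclideanLin v) := by
  have hdet : LinearMap.det M⁻¹.toEuclideanLin = M.det⁻¹ := by
    rw [LinearMap.det_toLpLin, Matrix.det_nonsing_inv, Ring.inverse_eq_inv']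
  have hne : LinearMap.det M⁻¹.toEuclideanLin ≠ 0 := by
    rw [hdet]; exact inv_ne_zero hM.ne_zero
  have hmap := Measure.map_linearMap_addHaar_eq_smul_addHaar (volume : Measure (Space d)) hne
  have hcont : Continuous M⁻¹.toEuclideanLin := LinearMap.continuous_of_finiteDimensional _
  rw [← integral_map hcont.aemeasurable (hh.aestronglyMeasurable), hmap, integral_smul_measure,
    hdet, inv_inv, ENNReal.toReal_ofReal (abs_nonneg _), Complex.real_smul, ← mul_assoc,
    ← Complex.ofReal_mul, inv_mul_cancel₀ (abs_ne_zero.2 hM.ne_zero), Complex.ofReal_one, one_mul]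

/-- The Fourier transform of the chirp `Θ_M`, damped by a Gaussian. -/
lemma fourier_chirp_mul_gauss {M : Matrix (Fin d) (Fin d) ℝ} (hM : IsUnit M.det) {c : ℝ}
    (hc : 0 < c) (z : Phase d) :
    𝓕 (fun ζ : Phase d => chirp M ζ * gauss (Phase d) (c • ζ)) z
      = ((|M.det|⁻¹ : ℝ) : ℂ) * ∫ u : Space d, (Real.fourierChar
          (-⟪M⁻¹.toEuclideanLin (c • u - z.pos), z.freq⟫) : ℂ) *
        gauss (Space d) (c • M⁻¹.toEuclideanLin (c • u - z.pos)) * gauss (Space d) u := by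
  have hMM : ∀ v : Space d, M.toEuclideanLin (M⁻¹.toEuclideanLin v) = v := fun v => by
    rw [← LinearMap.comp_apply, ← Matrix.toLpLin_mul_same, Matrix.mul_nonsing_inv _ hM]
    simp [Matrix.toLpLin_one]
  set k : Space d → ℂ := fun η => (Real.fourierChar (-⟪η, z.freq⟫) : ℂ) *
    gauss (Space d) (c • η) * gauss (Space d) (c⁻¹ • (M.toEuclideanLin η + z.pos)) with hk
  have hkc : Continuous k := by
    have h1 : Continuous fun η : Space d => -⟪η, z.freq⟫ := by fun_prop
    have h2 : Continuous M.toEuclideanLin := LinearMap.continuous_of_finiteDimensional _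
    exact ((continuous_subtype_val.comp (Real.continuous_fourierChar.comp h1)).mul
      (continuous_gauss.comp (by fun_prop))).mul (continuous_gauss.comp (by fun_prop))
  have hi := (Phase.integrable_iff _).1 ((Real.fourierIntegral_convergent_iff z).2
    (integrable_chirp_mul_gauss M hc.ne'))
  have e1 : 𝓕 (fun ζ : Phase d => chirp M ζ * gauss (Phase d) (c • ζ)) z
      = (((c ^ d)⁻¹ : ℝ) : ℂ) * ∫ η, k η := by
    rw [Real.fourier_eq, Phase.integral_eq]
    rw [Measure.volume_eq_prod] at hi ⊢
    rw [integral_prod_symm _ hi, ← integral_const_mul]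
    congr 1; ext η
    have h := integral_fourierChar_mul_gauss_smul hc (M.toEuclideanLin η + z.pos)
    calc _ = (Real.fourierChar (-⟪η, z.freq⟫) : ℂ) * gauss (Space d) (c • η) *
          ∫ ξ : Space d, (Real.fourierChar (-⟪ξ, M.toEuclideanLin η + z.pos⟫) : ℂ) *
            gauss (Space d) (c • ξ) := by
          rw [← integral_const_mul]
          congr 1; ext ξ
          have e2 : c • Phase.mk ξ η = Phase.mk (c • ξ) (c • η) := Phase.ext' rfl rfl
          have e3 : (Real.fourierChar (-⟪Phase.mk ξ η, z⟫) : ℂ) *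
              Real.fourierChar (-⟪ξ, M.toEuclideanLin η⟫)
              = Real.fourierChar (-⟪η, z.freq⟫) *
                Real.fourierChar (-⟪ξ, M.toEuclideanLin η + z.pos⟫) := by
            rw [← fourierChar_coe_add, ← fourierChar_coe_add, Phase.inner_eq, inner_add_right]
            congr 2
            simp only [Phase.pos_mk, Phase.freq_mk]; ring
          rw [Circle.smul_def, smul_eq_mul, chirp_apply, e2, gauss_mk]
          simp only [Phase.pos_mk, Phase.freq_mk]
          linear_combination (gauss (Space d) (c • ξ) * gauss (Space d) (c • η)) * e3
      _ = _ := by rw [h, hk]; ring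
  -- Substituting `η = M⁻¹(cu - z.pos)` cancels `c^{-d}` and turns the Gaussian that concentrates as
  -- `c → 0` into the fixed `gauss u`, ready for dominated convergence.
  have e4 := Measure.integral_comp_smul (volume : Measure (Space d))
    (fun v : Space d => k (M⁻¹.toEuclideanLin (v - z.pos))) c
  rw [integral_sub_right_eq_self (fun v : Space d => k (M⁻¹.toEuclideanLin v)) z.pos,
    finrank_euclideanSpace_fin, abs_of_pos (by positivity), Complex.real_smul] at e4
  rw [e1, integral_comp_toEuclideanLin hM hkc, mul_left_comm, ← e4]
  congr 2; ext u
  simp only [hk, hMM, sub_add_cancel, smul_smul, inv_mul_cancel₀ hc.ne', one_smul]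

lemma integral_gauss {V : Type*} [NormedAddCommGroup V] [InnerProductSpace ℝ V]
    [FiniteDimensional ℝ V] [MeasurableSpace V] [BorelSpace V] : ∫ u, gauss V u = 1 := by
  have := fourier_gauss (0 : V)
  simpa [Real.fourier_eq, gauss] using! this

/-- The bound is uniform in both `c` and `z`, so a multiple of `|F|` dominates when the damping is
removed under the integral against `F`. -/
lemma norm_fourier_chirp_mul_gauss_le {M : Matrix (Fin d) (Fin d) ℝ} (hM : IsUnit M.det) {c : ℝ}
    (hc : 0 < c) (z : Phase d) :
    ‖𝓕 (fun ζ : Phase d => chirp M ζ * gauss (Phase d) (c • ζ)) z‖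
      ≤ |M.det|⁻¹ * ∫ u : Space d, ‖gauss (Space d) u‖ := by
  rw [fourier_chirp_mul_gauss hM hc, norm_mul, Complex.norm_real,
    Real.norm_of_nonneg (by positivity)]
  refine mul_le_mul_of_nonneg_left ((norm_integral_le_integral_norm _).trans
    (integral_mono_of_nonneg (Filter.Eventually.of_forall fun u => norm_nonneg _)
      integrable_gauss.norm (Filter.Eventually.of_forall fun u => ?_))) (by positivity)
  dsimp only
  rw [norm_mul, norm_mul, Circle.norm_coe, one_mul]
  exact mul_le_of_le_one_left (norm_nonneg _) (norm_gauss_le _)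

lemma tendsto_fourier_chirp_mul_gauss {M : Matrix (Fin d) (Fin d) ℝ} (hM : IsUnit M.det)
    {c : ℕ → ℝ} (hc : ∀ n, 0 < c n) (hlim : Filter.Tendsto c Filter.atTop (nhds 0))
    (z : Phase d) :
    Filter.Tendsto (fun n => 𝓕 (fun ζ : Phase d => chirp M ζ * gauss (Phase d) (c n • ζ)) z)
      Filter.atTop (nhds (explicitKernel M z)) := by
  simp only [fourier_chirp_mul_gauss hM (hc _)]
  rw [explicitKernel_apply]
  refine Filter.Tendsto.const_mul _ ?_
  have hT : Continuous M⁻¹.toEuclideanLin := LinearMap.continuous_of_finiteDimensional _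
  have hcont : ∀ u : Space d, Continuous fun s : ℝ => (Real.fourierChar
      (-⟪M⁻¹.toEuclideanLin (s • u - z.pos), z.freq⟫) : ℂ) *
      gauss (Space d) (s • M⁻¹.toEuclideanLin (s • u - z.pos)) * gauss (Space d) u := fun u => by
    have h1 : Continuous fun s : ℝ => -⟪M⁻¹.toEuclideanLin (s • u - z.pos), z.freq⟫ := by fun_prop
    exact ((continuous_subtype_val.comp (Real.continuous_fourierChar.comp h1)).mul
      (continuous_gauss.comp (by fun_prop))).mul continuous_const
  have hcont' : ∀ s : ℝ, Continuous fun u : Space d => (Real.fourierChar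
      (-⟪M⁻¹.toEuclideanLin (s • u - z.pos), z.freq⟫) : ℂ) *
      gauss (Space d) (s • M⁻¹.toEuclideanLin (s • u - z.pos)) * gauss (Space d) u := fun s => by
    have h1 : Continuous fun u : Space d => -⟪M⁻¹.toEuclideanLin (s • u - z.pos), z.freq⟫ := by
      fun_prop
    exact ((continuous_subtype_val.comp (Real.continuous_fourierChar.comp h1)).mul
      (continuous_gauss.comp (by fun_prop))).mul continuous_gauss
  have e : (Real.fourierChar (-⟪M⁻¹.toEuclideanLin (-z.pos), z.freq⟫) : ℂ)
      = ∫ u : Space d, (Real.fourierChar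
        (-⟪M⁻¹.toEuclideanLin ((0 : ℝ) • u - z.pos), z.freq⟫) : ℂ) *
        gauss (Space d) ((0 : ℝ) • M⁻¹.toEuclideanLin ((0 : ℝ) • u - z.pos)) *
          gauss (Space d) u := by
    have h0 : gauss (Space d) 0 = 1 := by simp [gauss]
    simp only [zero_smul, zero_sub, h0, mul_one]
    rw [integral_const_mul, integral_gauss, mul_one]
  rw [e]
  refine tendsto_integral_of_dominated_convergence (fun u => ‖gauss (Space d) u‖)
    (fun n => (hcont' _).aestronglyMeasurable) integrable_gauss.norm
    (fun n => Filter.Eventually.of_forall fun u => ?_)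
    (Filter.Eventually.of_forall fun u => ((hcont u).tendsto 0).comp hlim)
  rw [norm_mul, norm_mul, Circle.norm_coe, one_mul]
  exact mul_le_of_le_one_left (norm_nonneg _) (norm_gauss_le _)

/-- For invertible `M` the kernel `θ_M` is an explicit chirp. -/
lemma cohenKernel_eq_explicitKernel {M : Matrix (Fin d) (Fin d) ℝ} (hM : IsUnit M.det) :
    cohenKernel M = FeichtingerDual.ofFun (explicitKernel M) := by
  refine Subtype.ext (LinearMap.ext fun F => ?_)
  change ∫ ζ, chirp M ζ * 𝓕 (F : Phase d → ℂ) ζ = ∫ z, explicitKernel M z * (F : Phase d → ℂ) z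
  have hF : MemFeichtinger (F : Phase d → ℂ) := F.2
  set c : ℕ → ℝ := fun n => 1 / ((n : ℝ) + 1) with hcdef
  have hc : ∀ n, 0 < c n := fun n => by positivity
  have hlim : Filter.Tendsto c Filter.atTop (nhds 0) := tendsto_one_div_add_atTop_nhds_zero_nat
  have hpars : ∀ n, ∫ ζ, (chirp M ζ * gauss (Phase d) (c n • ζ)) * 𝓕 (F : Phase d → ℂ) ζ
      = ∫ z, 𝓕 (fun ζ : Phase d => chirp M ζ * gauss (Phase d) (c n • ζ)) z *
        (F : Phase d → ℂ) z := fun n => by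
    have h := VectorFourier.integral_fourierIntegral_smul_eq_flip (L := innerₗ (Phase d))
      Real.continuous_fourierChar continuous_inner
      (integrable_chirp_mul_gauss M (hc n).ne') hF.2.1
    symm
    simpa using! h
  -- On this side the majorant is `|𝓕F|`, integrable because `F` lies in `S₀`.
  have hleft : Filter.Tendsto
      (fun n => ∫ ζ, (chirp M ζ * gauss (Phase d) (c n • ζ)) * 𝓕 (F : Phase d → ℂ) ζ)
      Filter.atTop (nhds (∫ ζ, chirp M ζ * 𝓕 (F : Phase d → ℂ) ζ)) := by
    refine tendsto_integral_of_dominated_convergence (fun ζ => ‖𝓕 (F : Phase d → ℂ) ζ‖)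
      (fun n => ?_) hF.integrable_fourier.norm
      (fun n => Filter.Eventually.of_forall fun ζ => ?_)
      (Filter.Eventually.of_forall fun ζ => ?_)
    · exact (integrable_chirp_mul_gauss M (hc n).ne').aestronglyMeasurable.mul
        hF.integrable_fourier.aestronglyMeasurable
    · rw [norm_mul, norm_mul, chirp_apply, Circle.norm_coe, one_mul]
      exact mul_le_of_le_one_left (norm_nonneg _) (norm_gauss_le _)
    · have h0 : gauss (Phase d) ((0 : ℝ) • ζ) = 1 := by simp [gauss]
      have h1 : Continuous fun s : ℝ =>
          (chirp M ζ * gauss (Phase d) (s • ζ)) * 𝓕 (F : Phase d → ℂ) ζ :=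
        (continuous_const.mul (continuous_gauss.comp (by fun_prop))).mul continuous_const
      have h2 := (h1.tendsto 0).comp hlim
      rwa [h0, mul_one] at h2
  have hright : Filter.Tendsto
      (fun n => ∫ z, 𝓕 (fun ζ : Phase d => chirp M ζ * gauss (Phase d) (c n • ζ)) z *
        (F : Phase d → ℂ) z)
      Filter.atTop (nhds (∫ z, explicitKernel M z * (F : Phase d → ℂ) z)) := by
    refine tendsto_integral_of_dominated_convergence
      (fun z => (|M.det|⁻¹ * ∫ u : Space d, ‖gauss (Space d) u‖) * ‖(F : Phase d → ℂ) z‖)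
      (fun n => ?_) (hF.2.1.norm.const_mul _)
      (fun n => Filter.Eventually.of_forall fun z => ?_)
      (Filter.Eventually.of_forall fun z =>
        (tendsto_fourier_chirp_mul_gauss hM hc hlim z).mul_const _)
    · exact (VectorFourier.fourierIntegral_continuous Real.continuous_fourierChar
        continuous_inner (integrable_chirp_mul_gauss M (hc n).ne')).aestronglyMeasurable.mul
        hF.2.1.aestronglyMeasurable
    · rw [norm_mul]
      exact mul_le_mul_of_nonneg_right (norm_fourier_chirp_mul_gauss_le hM (hc n) z)
        (norm_nonneg _)
  simp only [hpars] at hleft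
  exact tendsto_nhds_unique hleft hright

end ExplicitKernel

/-! ### Covariance under time-frequency shifts -/

section Covariance

variable {d : ℕ}

/-- The time-frequency shift `t ↦ exp(2πi t·b) f(t - a)` of a Schwartz function. -/
def timeFreqShift (a b : Space d) (f : 𝓢(Space d, ℂ)) : 𝓢(Space d, ℂ) :=
  SchwartzMap.smulLeftCLM ℂ (fun t : Space d => (Real.fourierChar ⟪t, b⟫ : ℂ))
    (f.compSubConstCLM ℂ a)

lemma timeFreqShift_apply (a b : Space d) (f : 𝓢(Space d, ℂ)) (t : Space d) :
    timeFreqShift a b f t = (Real.fourierChar ⟪t, b⟫ : ℂ) * f (t - a) := by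
  have h : Function.HasTemperateGrowth fun t : Space d => (Real.fourierChar ⟪t, b⟫ : ℂ) :=
    hasTemperateGrowth_fourierChar.comp (Function.hasTemperateGrowth_inner_left b)
  rw [timeFreqShift, SchwartzMap.smulLeftCLM_apply_apply h, smul_eq_mul,
    SchwartzMap.compSubConstCLM_apply]

lemma conj_fourierChar (r : ℝ) :
    conj (Real.fourierChar r : ℂ) = Real.fourierChar (-r) := by
  rw [← Circle.coe_inv_eq_conj, ← AddChar.map_neg_eq_inv]

/-- The phases at `x + y/2` and `x - y/2` combine to `e^{2πi y·b}`, a shift of the frequency by `b`;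
the translations shift `x` by `a`. -/
lemma wigner_timeFreqShift (a b : Space d) (f g : 𝓢(Space d, ℂ)) (z : Phase d) :
    wigner (timeFreqShift a b f) (timeFreqShift a b g) z = wigner f g (z - Phase.mk a b) := by
  rw [wigner_eq_fourier, wigner_eq_fourier, Real.fourier_eq, Real.fourier_eq]
  congr 1; ext y
  have e : (Real.fourierChar (-⟪y, z.freq⟫) : ℂ) *
      (Real.fourierChar ⟪z.pos + (1 / 2 : ℝ) • y, b⟫ *
        conj (Real.fourierChar ⟪z.pos - (1 / 2 : ℝ) • y, b⟫ : ℂ))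
      = Real.fourierChar (-⟪y, z.freq - b⟫) := by
    rw [conj_fourierChar, ← fourierChar_coe_add, ← fourierChar_coe_add]
    congr 2
    simp only [inner_add_left, inner_sub_left, inner_sub_right, real_inner_smul_left]
    ring
  simp only [timeFreqShift_apply, Circle.smul_def, smul_eq_mul, map_mul, Phase.freq_sub,
    Phase.pos_sub, Phase.pos_mk, Phase.freq_mk, ← e]
  rw [show z.pos - a + (1 / 2 : ℝ) • y = z.pos + (1 / 2 : ℝ) • y - a by abel,
    show z.pos - a - (1 / 2 : ℝ) • y = z.pos - (1 / 2 : ℝ) • y - a by abel]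
  ring

/-- Distributions in Cohen's class are covariant under time-frequency shifts. -/
lemma InCohenClass.covariant {Q : (Space d → ℂ) → (Space d → ℂ) → Phase d → ℂ}
    (hQ : InCohenClass Q) (a b : Space d) (f g : 𝓢(Space d, ℂ)) (z : Phase d) :
    Q (timeFreqShift a b f) (timeFreqShift a b g) z = Q f g (z - Phase.mk a b) := by
  obtain ⟨θ, hθ⟩ := hQ
  obtain ⟨F, hF, hQF⟩ := hθ f g
  obtain ⟨F', hF', hQF'⟩ := hθ (timeFreqShift a b f) (timeFreqShift a b g)
  rw [hQF, hQF']
  unfold convTempered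
  congr 1
  ext w
  rw [convTempered_arg, convTempered_arg, hF, hF', wigner_timeFreqShift, sub_right_comm]

end Covariance

/-! ### From covariance of the distribution to its integrand -/

section MatrixWignerIntegrand

variable {d : ℕ} {A : Matrix (Fin d ⊕ Fin d) (Fin d ⊕ Fin d) ℝ}

lemma toEuclideanLin_mk (A : Matrix (Fin d ⊕ Fin d) (Fin d ⊕ Fin d) ℝ) (x y : Space d) :
    A.toEuclideanLin (Phase.mk x y)
      = Phase.mk (A.toBlocks₁₁.toEuclideanLin x + A.toBlocks₁₂.toEuclideanLin y)
        (A.toBlocks₂₁.toEuclideanLin x + A.toBlocks₂₂.toEuclideanLin y) := by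
  ext i
  rcases i with i | i <;>
  simp [Phase.mk, Matrix.mulVec, dotProduct, Fintype.sum_sum_type, Matrix.toBlocks₁₁,
    Matrix.toBlocks₁₂, Matrix.toBlocks₂₁, Matrix.toBlocks₂₂]

lemma toEuclideanLin_nonsing_inv (hA : IsUnit A.det) (z : Phase d) :
    A.toEuclideanLin (A⁻¹.toEuclideanLin z) = z := by
  rw [← LinearMap.comp_apply, ← Matrix.toLpLin_mul_same, Matrix.mul_nonsing_inv _ hA]
  simp [Matrix.toLpLin_one]

lemma nonsing_inv_toEuclideanLin (hA : IsUnit A.det) (z : Phase d) :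
    A⁻¹.toEuclideanLin (A.toEuclideanLin z) = z := by
  rw [← LinearMap.comp_apply, ← Matrix.toLpLin_mul_same, Matrix.nonsing_inv_mul _ hA]
  simp [Matrix.toLpLin_one]

/-- The integrand of the matrix-Wigner distribution. -/
def matrixPair (A : Matrix (Fin d ⊕ Fin d) (Fin d ⊕ Fin d) ℝ) (f g : Space d → ℂ)
    (x y : Space d) : ℂ :=
  f (A.toBlocks₁₁.toEuclideanLin x + A.toBlocks₁₂.toEuclideanLin y) *
    conj (g (A.toBlocks₂₁.toEuclideanLin x + A.toBlocks₂₂.toEuclideanLin y))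

/-- Since `A` is invertible, `y ↦ A(x,y)` is an injective affine map, hence antilipschitz, and
composition with it preserves Schwartz functions. This makes Fourier injectivity available pointwise
in `y`. -/
lemma exists_schwartz_eq_matrixPair (hA : IsUnit A.det) (f g : 𝓢(Space d, ℂ)) (x : Space d) :
    ∃ K : 𝓢(Space d, ℂ), ∀ y, K y = matrixPair A f g x y := by
  set B : Space d →ₗ[ℝ] Phase d := A.toEuclideanLin ∘ₗ
    (Phase.equivProd (d := d)).symm.toLinearMap ∘ₗ LinearMap.inr ℝ (Space d) (Space d) with hB
  have hBa : ∀ y, B y = A.toEuclideanLin (Phase.mk 0 y) := fun y => rfl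
  have hker : LinearMap.ker B = ⊥ := by
    refine LinearMap.ker_eq_bot.2 fun y y' h => ?_
    have h' := congrArg A⁻¹.toEuclideanLin h
    rw [hBa, hBa, nonsing_inv_toEuclideanLin hA, nonsing_inv_toEuclideanLin hA] at h'
    exact congrArg Phase.freq h'
  obtain ⟨K, -, hK⟩ := B.exists_antilipschitzWith hker
  have hg : Function.HasTemperateGrowth fun y => A.toEuclideanLin (Phase.mk x 0) + B y :=
    (Function.HasTemperateGrowth.const _).add (LinearMap.toContinuousLinearMap B).hasTemperateGrowth
  have hanti : AntilipschitzWith K fun y => A.toEuclideanLin (Phase.mk x 0) + B y := fun y y' => by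
    rw [edist_add_left]; exact hK y y'
  refine ⟨compCLMOfAntilipschitz ℂ hg hanti (schwartzTensor Phase.posL Phase.freqL Phase.norm_le f
    (SchwartzMap.postcompCLM (𝕜 := ℝ) (Complex.conjCLE : ℂ →L[ℝ] ℂ) g)), fun y => ?_⟩
  rw [compCLMOfAntilipschitz_apply, Function.comp, schwartzTensor_apply,
    SchwartzMap.postcompCLM_apply, hBa, ← map_add]
  have e : Phase.mk x 0 + Phase.mk 0 y = Phase.mk x y := Phase.ext' (by simp) (by simp)
  rw [e, toEuclideanLin_mk]
  rfl

lemma eq_of_fourier_eq {V : Type*} [NormedAddCommGroup V] [InnerProductSpace ℝ V]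
    [FiniteDimensional ℝ V] [MeasurableSpace V] [BorelSpace V] {F G : 𝓢(V, ℂ)}
    (h : ∀ w, 𝓕 (F : V → ℂ) w = 𝓕 (G : V → ℂ) w) : F = G := by
  have hF := F.continuous.fourierInv_fourier_eq F.integrable (𝓕 F).integrable
  have hG := G.continuous.fourierInv_fourier_eq G.integrable (𝓕 G).integrable
  rw [funext h, hG] at hF
  exact DFunLike.coe_injective hF.symm

/-- The covariance of Cohen's class, read off on the integrand of the matrix-Wigner distribution. -/
lemma InCohenClass.matrixPair_eq (hA : IsUnit A.det) (hQ : InCohenClass (matrixWigner A))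
    (f : 𝓢(Space d, ℂ)) (a b x y : Space d) :
    matrixPair A (timeFreqShift a b f) (timeFreqShift a b f) x y
      = (Real.fourierChar ⟪y, b⟫ : ℂ) * matrixPair A f f (x - a) y := by
  obtain ⟨K, hK⟩ := exists_schwartz_eq_matrixPair hA (timeFreqShift a b f) (timeFreqShift a b f) x
  obtain ⟨K', hK'⟩ := exists_schwartz_eq_matrixPair hA f f (x - a)
  have h : K = timeFreqShift 0 b K' := by
    refine eq_of_fourier_eq fun ω => ?_
    have h1 := hQ.covariant a b f f (Phase.mk x ω)
    rw [matrixWigner_eq_fourier, matrixWigner_eq_fourier] at h1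
    have e1 : 𝓕 (K : Space d → ℂ) ω = 𝓕 (K' : Space d → ℂ) (ω - b) := by
      rw [show (K : Space d → ℂ) = _ from funext hK, show (K' : Space d → ℂ) = _ from funext hK']
      exact h1
    rw [e1, Real.fourier_eq, Real.fourier_eq]
    congr 1; ext t
    rw [timeFreqShift_apply, sub_zero, Circle.smul_def, Circle.smul_def, smul_eq_mul, smul_eq_mul,
      ← mul_assoc, ← fourierChar_coe_add]
    congr 3
    rw [inner_sub_right]; ring
  rw [← hK, h, timeFreqShift_apply, sub_zero, hK']

end MatrixWignerIntegrand

/-! ### Covariance determines the blocks of `A` -/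

section CohenClass

variable {d : ℕ}

/-- Knowing the nonvanishing set exactly converts "this product is nonzero" into norm inequalities,
and back. -/
lemma exists_schwartz_bump (d : ℕ) :
    ∃ h : 𝓢(Space d, ℂ), ∀ t, h t ≠ 0 ↔ ‖t‖ < 2 := by
  let φ : ContDiffBump (0 : Space d) := ⟨1, 2, one_pos, one_lt_two⟩
  have hs : HasCompactSupport fun t : Space d => (φ t : ℂ) :=
    φ.hasCompactSupport.comp_left (g := fun r : ℝ => (r : ℂ)) Complex.ofReal_zero
  refine ⟨hs.toSchwartzMap (Complex.ofRealCLM.contDiff.comp φ.contDiff), fun t => ?_⟩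
  change ((φ t : ℝ) : ℂ) ≠ 0 ↔ _
  rw [Complex.ofReal_ne_zero, ← Function.mem_support, φ.support_eq, mem_ball_zero_iff]

lemma eq_zero_of_norm_lt {E F : Type*} [NormedAddCommGroup E] [NormedSpace ℝ E]
    [NormedAddCommGroup F] [NormedSpace ℝ F] {T : E →ₗ[ℝ] F} {C : ℝ} (h : ∀ x, ‖T x‖ < C) :
    T = 0 := by
  ext x
  by_contra hx
  have hx' : 0 < ‖T x‖ := norm_pos_iff.2 hx
  have h1 := h ((C / ‖T x‖) • x)
  rw [map_smul, norm_smul, Real.norm_eq_abs] at h1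
  have h2 : C / ‖T x‖ * ‖T x‖ = C := div_mul_cancel₀ _ hx'.ne'
  nlinarith [le_abs_self (C / ‖T x‖)]

/-- If `v ≠ 0`, then `b = v / (2|v|²)` makes the inner product `1/2`, where the character is `-1`.
-/
lemma eq_zero_of_fourierChar_inner_eq_one {V : Type*} [NormedAddCommGroup V]
    [InnerProductSpace ℝ V] {v : V} (h : ∀ b : V, (Real.fourierChar ⟪v, b⟫ : ℂ) = 1) : v = 0 := by
  by_contra hv
  have h1 := h ((1 / (2 * ‖v‖ ^ 2)) • v)
  have hv' : ‖v‖ ≠ 0 := norm_ne_zero_iff.2 hv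
  have h2 : ⟪v, (1 / (2 * ‖v‖ ^ 2)) • v⟫ = 1 / 2 := by
    rw [real_inner_smul_right, real_inner_self_eq_norm_sq]; field_simp
  rw [h2, Real.fourierChar_apply] at h1
  have h3 : ((2 * Real.pi * (1 / 2) : ℝ) : ℂ) * Complex.I = Real.pi * Complex.I := by
    push_cast; ring
  rw [h3, Complex.exp_pi_mul_I] at h1
  norm_num at h1

/-- A matrix-Wigner distribution in Cohen's class has matrix `A_M` for some `M`. -/
lemma InCohenClass.exists_eq_cohenMatrix {A : Matrix (Fin d ⊕ Fin d) (Fin d ⊕ Fin d) ℝ}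
    (hA : IsUnit A.det) (hQ : InCohenClass (matrixWigner A)) :
    ∃ M : Matrix (Fin d) (Fin d) ℝ, A = cohenMatrix M := by
  obtain ⟨h, hh⟩ := exists_schwartz_bump d
  have h0 : h 0 ≠ 0 := (hh 0).2 (by simp)
  have hone : ∀ B : Matrix (Fin d) (Fin d) ℝ, (∀ v, B.toEuclideanLin v = v) → B = 1 := by
    intro B hB
    apply Matrix.toEuclideanLin.injective
    ext1 v
    rw [hB]; simp [Matrix.toLpLin_one]
  have hnorm : ∀ a : Space d, ‖a - A.toBlocks₁₁.toEuclideanLin a‖ < 2 ∧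
      ‖a - A.toBlocks₂₁.toEuclideanLin a‖ < 2 := by
    intro a
    -- The point is chosen so that both arguments equal `a`. After the shift by `a` the left side is
    -- `|h(0)|² ≠ 0`, so the right side `h(a - A₁₁a) conj h(a - A₂₁a)` is nonzero, which bounds both
    -- linear maps on the whole space.
    set w : Phase d := A⁻¹.toEuclideanLin (Phase.mk a a) with hw
    have hw' : A.toEuclideanLin (Phase.mk w.pos w.freq) = Phase.mk a a := by
      rw [Phase.mk_pos_freq, hw, toEuclideanLin_nonsing_inv hA]
    rw [toEuclideanLin_mk] at hw'
    have hp : A.toBlocks₁₁.toEuclideanLin w.pos + A.toBlocks₁₂.toEuclideanLin w.freq = a :=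
      congrArg Phase.pos hw'
    have hq : A.toBlocks₂₁.toEuclideanLin w.pos + A.toBlocks₂₂.toEuclideanLin w.freq = a :=
      congrArg Phase.freq hw'
    have e := hQ.matrixPair_eq hA h a 0 w.pos w.freq
    simp only [matrixPair, timeFreqShift_apply, hp, hq, map_sub, sub_add_eq_add_sub, sub_self,
      inner_zero_right, AddChar.map_zero_eq_one, Circle.coe_one, one_mul] at e
    have hne : h 0 * conj (h 0) ≠ 0 := mul_ne_zero h0 ((map_ne_zero _).2 h0)
    rw [e] at hne
    exact ⟨(hh _).1 (left_ne_zero_of_mul hne),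
      (hh _).1 ((map_ne_zero _).1 (right_ne_zero_of_mul hne))⟩
  have h11 : A.toBlocks₁₁ = 1 := hone _ fun v => by
    have := eq_zero_of_norm_lt (T := LinearMap.id - A.toBlocks₁₁.toEuclideanLin)
      fun a => (hnorm a).1
    exact (sub_eq_zero.1 (LinearMap.congr_fun this v)).symm
  have h21 : A.toBlocks₂₁ = 1 := hone _ fun v => by
    have := eq_zero_of_norm_lt (T := LinearMap.id - A.toBlocks₂₁.toEuclideanLin)
      fun a => (hnorm a).2
    exact (sub_eq_zero.1 (LinearMap.congr_fun this v)).symm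
  set D := A.toBlocks₁₂ - A.toBlocks₂₂ with hD
  have hsmall : ∀ y : Space d, ‖D.toEuclideanLin y‖ < 2 → D.toEuclideanLin y = y := by
    intro y hy
    rw [← sub_eq_zero]
    refine eq_zero_of_fourierChar_inner_eq_one fun b => ?_
    -- Taking `x = -A₂₂y` makes the arguments `Dy` and `0`. For `|Dy| < 2` the bump values cancel,
    -- leaving `e^{2πi Dy·b} = e^{2πi y·b}` for all `b`.
    have e := hQ.matrixPair_eq hA h 0 b (-A.toBlocks₂₂.toEuclideanLin y) y
    have hDy : -A.toBlocks₂₂.toEuclideanLin y + A.toBlocks₁₂.toEuclideanLin y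
        = D.toEuclideanLin y := by rw [hD, map_sub, LinearMap.sub_apply]; abel
    simp only [matrixPair, timeFreqShift_apply, h11, h21, Matrix.toLpLin_one, LinearMap.id_apply,
      sub_zero, hDy, neg_add_cancel, inner_zero_left, AddChar.map_zero_eq_one, Circle.coe_one,
      one_mul] at e
    have hne : h (D.toEuclideanLin y) * conj (h 0) ≠ 0 :=
      mul_ne_zero ((hh _).2 hy) ((map_ne_zero _).2 h0)
    rw [mul_assoc] at e
    have e' := mul_right_cancel₀ hne e
    rw [inner_sub_left, sub_eq_add_neg, fourierChar_coe_add, e', ← fourierChar_coe_add,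
      add_neg_cancel, AddChar.map_zero_eq_one, Circle.coe_one]
  have hD1 : D = 1 := hone _ fun v => by
    -- Scaling brings any vector into the range where `hsmall` applies, and linearity undoes it.
    set c : ℝ := 1 / (1 + ‖D.toEuclideanLin v‖) with hc
    have hc0 : 0 < c := by positivity
    have hcv : ‖D.toEuclideanLin (c • v)‖ < 2 := by
      rw [map_smul, norm_smul, Real.norm_of_nonneg hc0.le, hc, one_div_mul_eq_div,
        div_lt_iff₀ (by positivity)]
      linarith [norm_nonneg (D.toEuclideanLin v)]
    have := hsmall _ hcv
    rw [map_smul] at this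
    exact smul_right_injective _ hc0.ne' this
  refine ⟨A.toBlocks₁₂ - (1 / 2 : ℝ) • 1, ?_⟩
  have h22 : A.toBlocks₂₂ = A.toBlocks₁₂ - 1 := by rw [← hD1, hD]; abel
  have hhalf : A.toBlocks₁₂ - (1 / 2 : ℝ) • (1 : Matrix (Fin d) (Fin d) ℝ) - (1 / 2 : ℝ) • 1
      = A.toBlocks₁₂ - 1 := by module
  unfold cohenMatrix
  rw [sub_add_cancel, hhalf, ← h22]
  conv_lhs => rw [← Matrix.fromBlocks_toBlocks A, h11, h21]

end CohenClass

end TimeFreq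
end

open TimeFreq
theorem theorem3 (d : ℕ) :
    (∀ A : Matrix (Fin d ⊕ Fin d) (Fin d ⊕ Fin d) ℝ, IsUnit A.det →
      (InCohenClass (matrixWigner A) ↔
        ∃ M : Matrix (Fin d) (Fin d) ℝ, A = cohenMatrix M)) ∧
    ∀ M : Matrix (Fin d) (Fin d) ℝ,
      IsCohenKernel (matrixWigner (cohenMatrix M)) (𝓕 (temperedOfFun (chirp M))) ∧
      (∀ f g : Feichtinger (Space d), ∃ F : Feichtinger (Phase d),
        (∀ z : Phase d, (F : Phase d → ℂ) z = wigner f g z) ∧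
        ∀ z : Phase d,
          matrixWigner (cohenMatrix M) f g z = convFeichtinger F (cohenKernel M) z) ∧
      (IsUnit M.det →
        cohenKernel M = FeichtingerDual.ofFun (explicitKernel M)) := by
  refine ⟨fun A hA => ⟨fun hQ => hQ.exists_eq_cohenMatrix hA, ?_⟩, fun M =>
    ⟨isCohenKernel_cohenMatrix M, exists_convFeichtinger_eq M, cohenKernel_eq_explicitKernel⟩⟩
  rintro ⟨M, rfl⟩
  exact ⟨_, isCohenKernel_cohenMatrix M⟩
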